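/- Work in complex projective space $\mathbb{P}^3=\mathbb{P}(\mathbb{C}^4)$ and $\mathbb{P}^2=\mathbb{P}(\mathbb{C}^3)$. A camera is a real $3\times 4$ matrix $P$ of rank 3, seen as a rational map $\mathbb{P}^3\dashrightarrow\mathbb{P}^2$; its center is the point $\ker P$. Tuples of cameras always have pairwise distinct centers. For a tuple $\mathbf{P}=(P_1,\dots,P_n)$ let $\phi_{\mathbf P}:\mathbb{P}^3\dashrightarrow(\mathbb{P}^2)^n$, $x\mapsto(P_1x,\dots,P_nx)$, and call $z\in(\mathbb{P}^2)^n$ an image of $x\in\mathbb{P}^3$ if $(x,z)$ lies in the closure of the graph of $\phi_{\mathbf P}$, i.e. if for each $i$ either $P_ix=0$ or $z_i=[P_ix]$. A configuration $(\mathbf P,X)$, $X\subseteq\mathbb{P}^3$ any set of points, is a reconstruction of $S\subseteq(\mathbb{P}^2)^n$ if every $z\in S$ is an image of some $x\in X$ and every $x\in X$ has an image in $S$ (if $X$ contains no camera center this means $S=\phi_{\mathbf P}(X)$). Two configurations $(\mathbf P,X)$, $(\mathbf Q,Y)$ are equivalent if there is $H\in \mathrm{PGL}(4,\mathbb{R})$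 with $H(X)=Y$ and $P_iH^{-1}=Q_i$ (up to scale) for all $i$; they are conjugate if they are nonequivalent reconstructions of the same set $S$. The conjugate $(\mathbf Q,Y)$ is non-trivial if for all $i\ne j$ the fundamental matrices of $(P_i,P_j)$ and of $(Q_i,Q_j)$ are different (up to scale), where the fundamental matrix of $(P_i,P_j)$ is the matrix of the bilinear form $(u,v)\mapsto\det\begin{bmatrix}P_i&u&0\\P_j&0&v\end{bmatrix}$. A configuration is critical if it has a non-trivial conjugate. A (real) twisted cubic is the image of $[s:t]\mapsto[s^3:s^2t:st^2:t^3]$, $[s:t]\in\mathbb{P}^1(\mathbb{C})$, under a real projective transformation of $\mathbb{P}^3$; a (real) rational quartic is the image of $\mathbb{P}^1(\mathbb{C})$ under $[f_0:f_1:f_2:f_3]$, where the $f_i$ are linearly independent real binary quartic forms without a common zero over $\mathbb{C}$. Proposition. Let $\mathbf P=(P_1,P_2,P_3)$ be three cameras whose (distinct) centers lie on a line $L\subset\mathbb{P}^3$, and let $C\subset\mathbb{P}^3$ be a twisted cubic with $C\cap L=\emptyset$. Then: (1) for every set of points $X\subseteq C$, the configuration $(\mathbf P,X)$ is critical; (2)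 $(\mathbf P,C)$ has a non-trivial conjugate $(\mathbf Q,R)$ such that for every $X\subseteq C$ there is $Y\subseteq R$ for which $(\mathbf Q,Y)$ is a non-trivial conjugate of $(\mathbf P,X)$; (3) for every conjugate $(\mathbf Q,R)$ of $(\mathbf P,C)$, the set $R$ is a rational quartic curve containing the three centers of the cameras $Q_1,Q_2,Q_3$. -/

import Mathlib

open scoped LinearAlgebra.Projectivization Matrix

noncomputable section

/-- Complex projective 3-space, the space of space points. -/
abbrev Space : Type := ℙ ℂ (Fin 4 → ℂ)

/-- The complex projective plane, the space of image points. -/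
abbrev Image : Type := ℙ ℂ (Fin 3 → ℂ)

/-- A real matrix regarded as a complex matrix. -/
abbrev Matrix.toComplex {m n : Type*} (A : Matrix m n ℝ) : Matrix m n ℂ :=
  A.map (algebraMap ℝ ℂ)

/-- A (real projective pinhole) camera: a real `3 × 4` matrix of full rank. -/
structure Camera where
  mat : Matrix (Fin 3) (Fin 4) ℝ
  full_rank : mat.rank = 3

theorem Camera.finrank_ker (P : Camera) :
    Module.finrank ℂ (LinearMap.ker P.mat.toComplex.mulVecLin) = 1 := by
  have hs : LinearMap.range P.mat.mulVecLin = ⊤ := by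
    apply Submodule.eq_top_of_finrank_eq
    have h := P.full_rank
    rw [Matrix.rank] at h
    rw [h]; simp
  have hsurj : Function.Surjective P.mat.mulVec := LinearMap.range_eq_top.mp hs
  obtain ⟨B, hB⟩ := Matrix.mulVec_surjective_iff_exists_right_inverse.mp hsurj
  have hBC : P.mat.toComplex * B.toComplex = 1 := by
    rw [Matrix.toComplex, Matrix.toComplex, ← Matrix.map_mul, hB]
    exact Matrix.map_one _ (map_zero _) (map_one _)
  have hsC : LinearMap.range P.mat.toComplex.mulVecLin = ⊤ :=
    LinearMap.range_eq_top.mpr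
      (Matrix.mulVec_surjective_iff_exists_right_inverse.mpr ⟨_, hBC⟩)
  have h := LinearMap.finrank_range_add_finrank_ker P.mat.toComplex.mulVecLin
  rw [hsC, finrank_top] at h
  simp only [Module.finrank_fin_fun] at h
  omega

/-- The camera center: the point of projective 3-space given by the kernel of the camera matrix. -/
def Camera.center (P : Camera) : Space :=
  Projectivization.mk'' (LinearMap.ker P.mat.toComplex.mulVecLin) P.finrank_ker

/-- An `n`-tuple of cameras, with pairwise distinct camera centers. -/
structure CameraTuple (n : ℕ) where
  cam : Fin n → Camera
  distinct_centers : Function.Injective fun i => (cam i).center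

/-- `P.Sees x z`: the `n`-tuple of image points `z` is an image of the space point `x` under the
joint camera map of `P`, that is, `(x, z)` lies in the closure of the graph of the joint camera map
`x ↦ (P₁ x, …, Pₙ x)`. If `x` is no camera center, this says `z i = [Pᵢ x]` for all `i`; if
`x` is the center of the `i`-th camera, then `z i` is arbitrary and `z j = [Pⱼ x]` for `j ≠ i`. -/
def CameraTuple.Sees {n : ℕ} (P : CameraTuple n) (x : Space) (z : Fin n → Image) : Prop :=
  ∀ i, ∃ c : ℂ, (P.cam i).mat.toComplex *ᵥ x.rep = c • (z i).rep

/-- The configuration `(P, X)` of cameras and points is a reconstruction of the set `S` of image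
tuples. When `X` contains no camera center, this says that `S` is the image of `X` under the joint
camera map. A camera center in `X` may account for any image tuple in the closure of the graph. -/
def IsReconstruction {n : ℕ} (S : Set (Fin n → Image)) (P : CameraTuple n) (X : Set Space) :
    Prop :=
  (∀ z ∈ S, ∃ x ∈ X, P.Sees x z) ∧ ∀ x ∈ X, ∃ z ∈ S, P.Sees x z

/-- The real projective transformation of complex projective 3-space given by an invertible
real matrix. -/
def projTransform (H : GL (Fin 4) ℝ) : Space → Space :=
  Projectivization.map H.val.toComplex.mulVecLin (by
    have h : (H⁻¹).val.toComplex * H.val.toComplex = 1 := by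
      rw [Matrix.toComplex, Matrix.toComplex, ← Matrix.map_mul, ← Units.val_mul,
        inv_mul_cancel, Units.val_one]
      exact Matrix.map_one _ (map_zero _) (map_one _)
    intro v w hvw
    have h2 := congrArg (fun u => (H⁻¹).val.toComplex *ᵥ u) hvw
    simpa [Matrix.mulVec_mulVec, h] using h2)

/-- The condition `Pᵢ H⁻¹ = Qᵢ` for all `i`, as an equality of camera matrices up to scale. -/
def CamerasEquivVia {n : ℕ} (H : GL (Fin 4) ℝ) (P Q : CameraTuple n) : Prop :=
  ∀ i, ∃ c : ℝ, c ≠ 0 ∧ (P.cam i).mat * (H⁻¹).val = c • (Q.cam i).mat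

/-- Equivalence of configurations of cameras and points under the projective linear group. -/
def ConfigEquiv {n : ℕ} (P : CameraTuple n) (X : Set Space) (Q : CameraTuple n) (Y : Set Space) :
    Prop :=
  ∃ H : GL (Fin 4) ℝ, projTransform H '' X = Y ∧ CamerasEquivVia H P Q

/-- `(P, X)` and `(Q, Y)` are conjugate configurations: nonequivalent reconstructions of the same
set of image tuples. -/
def IsConjugate {n : ℕ} (P : CameraTuple n) (X : Set Space) (Q : CameraTuple n) (Y : Set Space) :
    Prop :=
  (∃ S : Set (Fin n → Image), IsReconstruction S P X ∧ IsReconstruction S Q Y) ∧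
    ¬ ConfigEquiv P X Q Y

/-- The bilinear form of the fundamental matrix of a pair of cameras `P`, `P'`:
`(u, v) ↦ det [P, u, 0; P', 0, v]`. -/
def fundamentalForm (P P' : Camera) (u v : Fin 3 → ℝ) : ℝ :=
  Matrix.det (Matrix.reindex finSumFinEquiv finSumFinEquiv
    (Matrix.fromBlocks P.mat (Matrix.of fun k (l : Fin 2) => if l = 0 then u k else 0)
      P'.mat (Matrix.of fun k (l : Fin 2) => if l = 0 then 0 else v k)) :
    Matrix (Fin 6) (Fin 6) ℝ)

/-- The fundamental matrices of the pairs `(P₁, P₂)` and `(Q₁, Q₂)` agree up to scale. -/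
def SameFundamental (P₁ P₂ Q₁ Q₂ : Camera) : Prop :=
  ∃ c : ℝ, c ≠ 0 ∧ ∀ u v, fundamentalForm P₁ P₂ u v = c * fundamentalForm Q₁ Q₂ u v

/-- A conjugate that witnesses non-trivial criticality: for every pair of views the
fundamental matrices on the two sides are different. -/
def IsNontrivialConjugate {n : ℕ} (P : CameraTuple n) (X : Set Space) (Q : CameraTuple n)
    (Y : Set Space) : Prop :=
  IsConjugate P X Q Y ∧
    ∀ i j, i ≠ j → ¬ SameFundamental (P.cam i) (P.cam j) (Q.cam i) (Q.cam j)

/-- `(P, X)` is a (non-trivial) critical configuration. -/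
def IsCritical {n : ℕ} (P : CameraTuple n) (X : Set Space) : Prop :=
  ∃ (Q : CameraTuple n) (Y : Set Space), IsNontrivialConjugate P X Q Y

/-- The vector `(s^d, s^(d-1) t, …, t^d)` of monomials of degree `d`. -/
def monomialVec (d : ℕ) (s t : ℂ) : Fin (d + 1) → ℂ :=
  fun k => s ^ (d - (k : ℕ)) * t ^ (k : ℕ)

/-- `C` is the image of the complex projective line under the morphism
`[s : t] ↦ [f₀ : f₁ : f₂ : f₃]`, where the `fᵢ` are four linearly independent real
binary forms of degree `d` (the rows of `B`) without a common zero over `ℂ`. -/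
def IsParamCurve (d : ℕ) (C : Set Space) : Prop :=
  ∃ B : Matrix (Fin 4) (Fin (d + 1)) ℝ,
    LinearIndependent ℝ B.row ∧
    (∀ s t : ℂ, (s ≠ 0 ∨ t ≠ 0) → B.toComplex *ᵥ monomialVec d s t ≠ 0) ∧
    C = {x | ∃ (s t : ℂ) (h : B.toComplex *ᵥ monomialVec d s t ≠ 0),
      (s ≠ 0 ∨ t ≠ 0) ∧ x = Projectivization.mk ℂ _ h}

/-- A (real) twisted cubic: the image of `[s^3 : s^2 t : s t^2 : t^3]` under a real projective
transformation of 3-space. -/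
def IsTwistedCubic (C : Set Space) : Prop := IsParamCurve 3 C

/-- A (real) rational quartic space curve. As the four quartic forms are linearly independent, the
curve spans 3-space, so it has degree at least 3; hence the parametrization is birational onto
the curve, and the curve has degree exactly 4. -/
def IsRationalQuartic (C : Set Space) : Prop := IsParamCurve 4 C

/-- A line in projective 3-space, given by a 2-dimensional subspace, as a set of points. -/
def IsLine (L : Set Space) : Prop :=
  ∃ W : Submodule ℂ (Fin 4 → ℂ), Module.finrank ℂ W = 2 ∧ L = {x | x.submodule ≤ W}

end

/-! Take coordinates in which the cubic is the moment curve m₃(s,t), with cameras M_i and centers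
b_i. Let S(l) be the 4×5 matrix with S(l) m₄ = l · m₃ for a binary linear form l. Everything rests
on `QuarticModel`: pairwise independent forms l_i, a 4×5 matrix B of rank 4 and cameras Q_i with Q_i
B = M_i S(l_i). Then Q_i sees B m₄ where M_i sees m₃, and the center of Q_i is the point of the
quartic B m₄ at the root of l_i.

Existence: if some φ in ℝ⁵ satisfies S(l_i) φ = b_i for all i, then M_i S(l_i) kills φ and so
factors through the projection B from φ. A dimension count gives a φ whose two windows of length
four lie on the line of centers (`exists_windows`). They span it, since otherwise φ would be a
geometric progression and the line would meet the cubic (`windows_det_ne_zero`). The conjugate is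
non-trivial because the factors l_i, l_j destroy the antisymmetry that an epipolar constraint
imposes on pairs of points (`not_forall_fundamentalForm_eq_zero`).

Uniqueness: for a conjugate with cameras T_i, triangulating the images of the cubic is a linear
system over ℝ[X], solved by some Y with T_i Y = c_i · M_i m₃ (`exists_polynomial_solution`). If the
c_i are all proportional, Y is a constant matrix applied to m₃, up to a factor, and the
configurations are equivalent (`configEquiv_of_transformation`). Otherwise let V be the span of the
four coordinates of Y. It contains c_i times every cubic cut out by a plane through b_i. Planes
through the line of centers give a pencil N common to the three nets, without base points because
the line misses the cubic. Since dim V ≤ 4, this forces c_i = q · l_i with l_i linear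
(`PencilTriple.exists_linear_factors`), so the T_i form a quartic model. Finally, no point off the
quartic has the same images, because no camera sees three points of the cubic on one ray
(`eq_smul_of_mulVec`). -/

/-! ### Multipliers of nets of cubics that share a coprime pencil -/

open Polynomial in
/-- A space of polynomials of degree at most three, regarded as binary cubic forms, any two
independent members of which have no common zero on the projective line. -/
def CoprimePencil (N : Submodule ℝ ℝ[X]) : Prop :=
  ∀ a ∈ N, ∀ b ∈ N, (∀ x y : ℝ, C x * a + C y * b = 0 → x = 0 ∧ y = 0) →
    ∀ (d : ℕ) (f g : ℝ[X]), f.natDegree ≤ 3 + d → g.natDegree ≤ 3 + d → a * f = b * g →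
      ∃ q : ℝ[X], q.natDegree ≤ d ∧ f = b * q ∧ g = a * q

open Polynomial in
/-- Three multipliers `cᵢ` that send the nets of cubics spanned by a coprime pencil `N` and `k₁`, `k₂`,
`s k₁ - t k₂` respectively into a space `V` of dimension at most four. -/
structure PencilTriple (N V : Submodule ℝ ℝ[X]) (k₁ k₂ c₁ c₂ c₃ : ℝ[X]) (s t : ℝ) : Prop where
  finrank_pencil : Module.finrank ℝ N = 2
  coprime : CoprimePencil N
  deg_pencil : ∀ a ∈ N, a.natDegree ≤ 3
  deg_k₁ : k₁.natDegree ≤ 3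
  deg_k₂ : k₂.natDegree ≤ 3
  indep_k : ∀ x y : ℝ, C x * k₁ + C y * k₂ ∈ N → x = 0 ∧ y = 0
  fin : FiniteDimensional ℝ V
  finrank_le : Module.finrank ℝ V ≤ 4
  s_ne : s ≠ 0
  t_ne : t ≠ 0
  c₃_ne : c₃ ≠ 0
  indep_c : ∀ x y : ℝ, C x * c₁ + C y * c₂ = 0 → x = 0 ∧ y = 0
  mem₁ : ∀ a ∈ N, c₁ * a ∈ V
  mem₂ : ∀ a ∈ N, c₂ * a ∈ V
  mem₃ : ∀ a ∈ N, c₃ * a ∈ V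
  mem_k₁ : c₁ * k₁ ∈ V
  mem_k₂ : c₂ * k₂ ∈ V
  mem_k₃ : c₃ * (C s * k₁ - C t * k₂) ∈ V

open Polynomial in
theorem Submodule.C_mul_mem {N : Submodule ℝ ℝ[X]} {a : ℝ[X]} (x : ℝ) (ha : a ∈ N) :
    C x * a ∈ N := by
  rw [← smul_eq_C_mul]; exact N.smul_mem x ha

namespace CoprimePencil

open Polynomial

variable {N : Submodule ℝ ℝ[X]}

theorem exists_const (hN : CoprimePencil N) {a b f g : ℝ[X]} (ha : a ∈ N) (hb : b ∈ N)
    (hab : ∀ x y : ℝ, C x * a + C y * b = 0 → x = 0 ∧ y = 0)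
    (hf : f.natDegree ≤ 3) (hg : g.natDegree ≤ 3) (h : a * f = b * g) :
    ∃ z : ℝ, f = b * C z ∧ g = a * C z := by
  obtain ⟨q, hq, h1, h2⟩ := hN a ha b hb hab 0 f g hf hg h
  obtain ⟨z, rfl⟩ := natDegree_eq_zero.mp (Nat.le_zero.mp hq)
  exact ⟨z, h1, h2⟩

theorem eq_zero_of_mul_eq (hN : CoprimePencil N) {a b f g : ℝ[X]} (ha : a ∈ N) (hb : b ∈ N)
    (hab : ∀ x y : ℝ, C x * a + C y * b = 0 → x = 0 ∧ y = 0)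
    (hfN : f ∈ N → False)
    (hf : f.natDegree ≤ 3) (hg : g.natDegree ≤ 3) (h : a * f = b * g) : False := by
  obtain ⟨z, h1, -⟩ := hN.exists_const ha hb hab hf hg h
  apply hfN
  rw [h1, mul_comm]
  exact Submodule.C_mul_mem z hb

end CoprimePencil

namespace PencilTriple

open Polynomial

variable {N V : Submodule ℝ ℝ[X]} {k₁ k₂ c₁ c₂ c₃ : ℝ[X]} {s t : ℝ}

theorem c₁_ne (h : PencilTriple N V k₁ k₂ c₁ c₂ c₃ s t) : c₁ ≠ 0 := by
  rintro rfl
  have := (h.indep_c 1 0 (by simp)).1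
  norm_num at this

theorem c₂_ne (h : PencilTriple N V k₁ k₂ c₁ c₂ c₃ s t) : c₂ ≠ 0 := by
  rintro rfl
  have := (h.indep_c 0 1 (by simp)).2
  norm_num at this

/-- Exchanging the roles of the first two members. -/
theorem swap (h : PencilTriple N V k₁ k₂ c₁ c₂ c₃ s t) :
    PencilTriple N V k₂ k₁ c₂ c₁ c₃ t s where
  finrank_pencil := h.finrank_pencil
  coprime := h.coprime
  deg_pencil := h.deg_pencil
  deg_k₁ := h.deg_k₂
  deg_k₂ := h.deg_k₁
  indep_k x y hxy := (h.indep_k y x (by rwa [add_comm])).symm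
  fin := h.fin
  finrank_le := h.finrank_le
  s_ne := h.t_ne
  t_ne := h.s_ne
  c₃_ne := h.c₃_ne
  indep_c x y hxy := (h.indep_c y x (by rwa [add_comm])).symm
  mem₁ := h.mem₂
  mem₂ := h.mem₁
  mem₃ := h.mem₃
  mem_k₁ := h.mem_k₂
  mem_k₂ := h.mem_k₁
  mem_k₃ := by
    have := V.neg_mem h.mem_k₃
    rwa [← mul_neg, neg_sub] at this

theorem k₁_notMem (h : PencilTriple N V k₁ k₂ c₁ c₂ c₃ s t) {x : ℝ} (hx : x ≠ 0) {a : ℝ[X]}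
    (ha : a ∈ N) : C x * k₁ + a ∉ N := by
  intro hm
  have := (h.indep_k x 0 (by simpa using (N.add_mem_iff_left ha).mp hm)).1
  exact hx this

/-- A nonzero solution would make a, b independent and produce five independent elements of V, whose
dimension is at most four. Hence c₁N and c₂N meet only in 0 and together fill V. -/
theorem eq_zero_of_mul_eq_mul (h : PencilTriple N V k₁ k₂ c₁ c₂ c₃ s t) {a b : ℝ[X]}
    (ha : a ∈ N) (hb : b ∈ N) (hab : c₁ * a = c₂ * b) : a = 0 ∧ b = 0 := by
  by_contra hne
  have hind : ∀ x y : ℝ, C x * a + C y * b = 0 → x = 0 ∧ y = 0 := by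
    intro x y hxy
    have hb0 : b ≠ 0 := by
      rintro rfl
      simp [h.c₁_ne] at hab
      exact hne ⟨hab, rfl⟩
    have : b * (C y * c₁ + C x * c₂) = 0 := by
      linear_combination c₁ * hxy - C x * hab
    exact (h.indep_c y x ((mul_eq_zero.mp this).resolve_left hb0)).symm
  have hli : LinearIndependent ℝ (![⟨c₁ * b, h.mem₁ b hb⟩, ⟨c₁ * a, h.mem₁ a ha⟩,
      ⟨c₂ * a, h.mem₂ a ha⟩, ⟨c₁ * k₁, h.mem_k₁⟩, ⟨c₂ * k₂, h.mem_k₂⟩] : Fin 5 → V) := by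
    rw [Fintype.linearIndependent_iff]
    intro g hg
    simp only [Fin.sum_univ_five, Subtype.ext_iff, Submodule.coe_add, Submodule.coe_smul,
      smul_eq_C_mul, Submodule.coe_zero] at hg
    simp only [Matrix.cons_val] at hg
    -- Multiplying the relation by a turns c₁ into c₂ b / a, so c₂ cancels and an identity between
    -- cubics remains, to which coprimality of a and b applies.
    have e1 : b * (C (g 0) * b + C (g 1) * a + C (g 3) * k₁)
        = a * (-(C (g 2) * a + C (g 4) * k₂)) := by
      apply mul_left_cancel₀ h.c₂_ne
      linear_combination a * hg - (C (g 0) * b + C (g 1) * a + C (g 3) * k₁) * hab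
    have d1 : (C (g 0) * b + C (g 1) * a + C (g 3) * k₁).natDegree ≤ 3 := by
      refine natDegree_add_le_of_degree_le (natDegree_add_le_of_degree_le ?_ ?_) ?_ <;>
      refine (natDegree_C_mul_le _ _).trans ?_
      exacts [h.deg_pencil b hb, h.deg_pencil a ha, h.deg_k₁]
    have d2 : (-(C (g 2) * a + C (g 4) * k₂)).natDegree ≤ 3 := by
      rw [natDegree_neg]
      refine natDegree_add_le_of_degree_le ?_ ?_ <;>
      refine (natDegree_C_mul_le _ _).trans ?_
      exacts [h.deg_pencil a ha, h.deg_k₂]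
    obtain ⟨z, h1, h2⟩ := h.coprime.exists_const hb ha
      (fun x y hxy => (hind y x (by rwa [add_comm])).symm) d1 d2 e1
    have g4 : g 4 = 0 := by
      refine (h.indep_k 0 (g 4) ?_).2
      have : C 0 * k₁ + C (g 4) * k₂ = - (C (g 2) * a) - C z * b := by
        rw [C_0]; linear_combination -h2
      rw [this]
      exact N.sub_mem (N.neg_mem (Submodule.C_mul_mem _ ha)) (Submodule.C_mul_mem _ hb)
    have g3 : g 3 = 0 := by
      refine (h.indep_k (g 3) 0 ?_).1
      have : C (g 3) * k₁ + C 0 * k₂ = C z * a - C (g 1) * a - C (g 0) * b := by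
        rw [C_0]; linear_combination h1
      rw [this]
      exact N.sub_mem (N.sub_mem (Submodule.C_mul_mem _ ha) (Submodule.C_mul_mem _ ha))
        (Submodule.C_mul_mem _ hb)
    rw [g4, C_0] at h2
    rw [g3, C_0] at h1
    have q1 := hind (g 2) z (by linear_combination -h2)
    have q2 := hind (g 1 - z) (g 0) (by rw [C_sub]; linear_combination h1)
    intro i
    fin_cases i
    · exact q2.2
    · have := q2.1; rw [q1.2, sub_zero] at this; exact this
    · exact q1.1
    · exact g3
    · exact g4
  have := h.fin
  have := hli.fintype_card_le_finrank
  have := h.finrank_le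
  simp at *
  omega

/-- Multiplication by `c₁` and `c₂` gives an injection of two copies of the pencil. -/
noncomputable def pairMap (h : PencilTriple N V k₁ k₂ c₁ c₂ c₃ s t) : (N × N) →ₗ[ℝ] V where
  toFun p := ⟨c₁ * p.1 + c₂ * p.2, V.add_mem (h.mem₁ _ p.1.2) (h.mem₂ _ p.2.2)⟩
  map_add' p q := by ext1; simp; ring
  map_smul' x p := by ext1; simp

theorem pairMap_injective (h : PencilTriple N V k₁ k₂ c₁ c₂ c₃ s t) :
    Function.Injective h.pairMap := by
  rw [← LinearMap.ker_eq_bot, LinearMap.ker_eq_bot']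
  rintro ⟨⟨a, ha⟩, ⟨b, hb⟩⟩ hp
  have hp' : c₁ * a + c₂ * b = 0 := congrArg Subtype.val hp
  have := h.eq_zero_of_mul_eq_mul ha (N.neg_mem hb) (by linear_combination hp')
  ext <;> simp [this.1, neg_eq_zero.mp this.2]

theorem finrank_prod (h : PencilTriple N V k₁ k₂ c₁ c₂ c₃ s t) :
    Module.finrank ℝ (N × N) = 4 := by
  have : FiniteDimensional ℝ N := Module.finite_of_finrank_pos (by rw [h.finrank_pencil]; norm_num)
  rw [Module.finrank_prod, h.finrank_pencil]

theorem finrank_eq (h : PencilTriple N V k₁ k₂ c₁ c₂ c₃ s t) : Module.finrank ℝ V = 4 := by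
  have := h.fin
  have := LinearMap.finrank_le_finrank_of_injective h.pairMap_injective
  rw [h.finrank_prod] at this
  exact le_antisymm h.finrank_le this

theorem exists_decomp (h : PencilTriple N V k₁ k₂ c₁ c₂ c₃ s t) {v : ℝ[X]} (hv : v ∈ V) :
    ∃ a ∈ N, ∃ b ∈ N, v = c₁ * a + c₂ * b := by
  have := h.fin
  have : FiniteDimensional ℝ N := Module.finite_of_finrank_pos (by rw [h.finrank_pencil]; norm_num)
  have hs := (LinearMap.injective_iff_surjective_of_finrank_eq_finrank
    (h.finrank_prod.trans h.finrank_eq.symm)).mp h.pairMap_injective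
  obtain ⟨⟨a, b⟩, hp⟩ := hs ⟨v, hv⟩
  exact ⟨a, a.2, b, b.2, (congrArg Subtype.val hp).symm⟩

/-- The two extra cubics can be moved by elements of the pencil. -/
theorem translate (h : PencilTriple N V k₁ k₂ c₁ c₂ c₃ s t) {a b : ℝ[X]} (ha : a ∈ N)
    (hb : b ∈ N) : PencilTriple N V (k₁ - a) (k₂ - b) c₁ c₂ c₃ s t where
  finrank_pencil := h.finrank_pencil
  coprime := h.coprime
  deg_pencil := h.deg_pencil
  deg_k₁ := natDegree_sub_le_of_le h.deg_k₁ (h.deg_pencil a ha)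
  deg_k₂ := natDegree_sub_le_of_le h.deg_k₂ (h.deg_pencil b hb)
  indep_k x y hxy := by
    refine h.indep_k x y ?_
    have : C x * k₁ + C y * k₂ = (C x * (k₁ - a) + C y * (k₂ - b)) + (C x * a + C y * b) := by ring
    rw [this]
    exact N.add_mem hxy (N.add_mem (Submodule.C_mul_mem _ ha) (Submodule.C_mul_mem _ hb))
  fin := h.fin
  finrank_le := h.finrank_le
  s_ne := h.s_ne
  t_ne := h.t_ne
  c₃_ne := h.c₃_ne
  indep_c := h.indep_c
  mem₁ := h.mem₁
  mem₂ := h.mem₂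
  mem₃ := h.mem₃
  mem_k₁ := by rw [mul_sub]; exact V.sub_mem h.mem_k₁ (h.mem₁ a ha)
  mem_k₂ := by rw [mul_sub]; exact V.sub_mem h.mem_k₂ (h.mem₂ b hb)
  mem_k₃ := by
    have : c₃ * (C s * (k₁ - a) - C t * (k₂ - b))
      = c₃ * (C s * k₁ - C t * k₂) - c₃ * (C s * a - C t * b) := by ring
    rw [this]
    exact V.sub_mem h.mem_k₃ (h.mem₃ _
      (N.sub_mem (Submodule.C_mul_mem _ ha) (Submodule.C_mul_mem _ hb)))

/-- Since V = c₁N ⊕ c₂N, the c₁N-part of c₁k₁ and the c₂N-part of c₂k₂ can be absorbed into k₁ and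
k₂. What is left exhibits the ratio c₁ : c₂ as a ratio of two cubics. -/
theorem exists_normalized (h : PencilTriple N V k₁ k₂ c₁ c₂ c₃ s t) :
    ∃ k₁' k₂' : ℝ[X], PencilTriple N V k₁' k₂' c₁ c₂ c₃ s t ∧
      (∃ β ∈ N, c₁ * k₁' = c₂ * β) ∧ ∃ α ∈ N, c₂ * k₂' = c₁ * α := by
  obtain ⟨a, ha, β, hβ, e1⟩ := h.exists_decomp h.mem_k₁
  obtain ⟨α, hα, b, hb, e2⟩ := h.exists_decomp h.mem_k₂
  exact ⟨k₁ - a, k₂ - b, h.translate ha hb, ⟨β, hβ, by linear_combination e1⟩,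
    ⟨α, hα, by linear_combination e2⟩⟩

end PencilTriple

namespace PencilTriple

open Polynomial

variable {N V : Submodule ℝ ℝ[X]} {k₁ k₂ c₁ c₂ c₃ : ℝ[X]} {s t : ℝ}

theorem exists_basis (h : PencilTriple N V k₁ k₂ c₁ c₂ c₃ s t) {n : ℝ[X]} (hn : n ∈ N)
    (hn0 : n ≠ 0) : ∃ m ∈ N, (∀ x y : ℝ, C x * n + C y * m = 0 → x = 0 ∧ y = 0) ∧
      ∀ a ∈ N, ∃ x y : ℝ, a = C x * n + C y * m := by
  have : FiniteDimensional ℝ N := Module.finite_of_finrank_pos (by rw [h.finrank_pencil]; norm_num)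
  have hli : LinearIndependent ℝ (![⟨n, hn⟩] : Fin 1 → N) := by
    rw [linearIndependent_unique_iff]
    simpa [Subtype.ext_iff] using hn0
  obtain ⟨⟨m, hm⟩, hli2⟩ := exists_linearIndependent_snoc_of_lt_finrank hli
    (by rw [h.finrank_pencil]; norm_num)
  have hli3 : LinearIndependent ℝ (![⟨n, hn⟩, ⟨m, hm⟩] : Fin 2 → N) := by
    have he : (Fin.snoc ![⟨n, hn⟩] ⟨m, hm⟩ : Fin 2 → N) = ![⟨n, hn⟩, ⟨m, hm⟩] := by
      ext i; fin_cases i <;> rfl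
    exact he ▸ hli2
  refine ⟨m, hm, fun x y hxy => ?_, fun a ha => ?_⟩
  · refine LinearIndependent.pair_iff.mp hli3 x y ?_
    ext1
    simpa [smul_eq_C_mul] using hxy
  · have htop := hli3.span_eq_top_of_card_eq_finrank (by simp [h.finrank_pencil])
    have : (⟨a, ha⟩ : N) ∈ Submodule.span ℝ (Set.range (![⟨n, hn⟩, ⟨m, hm⟩] : Fin 2 → N)) := by
      rw [htop]; trivial
    rw [Matrix.range_cons, Matrix.range_cons, Matrix.range_empty, Set.union_empty,
      Set.singleton_union, Submodule.mem_span_pair] at this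
    obtain ⟨x, y, hxy⟩ := this
    exact ⟨x, y, by simpa [smul_eq_C_mul, eq_comm] using congrArg Subtype.val hxy⟩

theorem natDegree_mul_le_six {f g : ℝ[X]} (hf : f.natDegree ≤ 3) (hg : g.natDegree ≤ 3) :
    (f * g).natDegree ≤ 3 + 3 :=
  natDegree_mul_le_of_le hf hg

/-- The third multiplier is a combination of the first two. -/
theorem exists_combination (h : PencilTriple N V k₁ k₂ c₁ c₂ c₃ s t) :
    ∃ x y : ℝ, c₃ = C x * c₁ + C y * c₂ := by
  -- Here c₂k = c₁n, so c₁ : c₂ = k : n; this n is completed to a basis n, m of the pencil.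
  obtain ⟨_, k, h', -, n, hn, hk⟩ := h.exists_normalized
  clear h
  have hkN : ∀ x : ℝ, x ≠ 0 → ∀ a ∈ N, C x * k + a ∉ N := fun x hx a ha => h'.swap.k₁_notMem hx ha
  have hk0 : k ≠ 0 := by
    rintro rfl
    exact hkN 1 one_ne_zero 0 N.zero_mem (by simp)
  have hn0 : n ≠ 0 := by
    rintro rfl
    simp [h'.c₂_ne, hk0] at hk
  obtain ⟨m, hm, hind, hspan⟩ := h'.exists_basis hn hn0
  have hind' : ∀ x y : ℝ, C x * m + C y * n = 0 → x = 0 ∧ y = 0 :=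
    fun x y hxy => (hind y x (by rwa [add_comm])).symm
  obtain ⟨α, hα, β, hβ, e1⟩ := h'.exists_decomp (h'.mem₃ n hn)
  obtain ⟨α', hα', β', hβ', e2⟩ := h'.exists_decomp (h'.mem₃ m hm)
  obtain ⟨a, b, rfl⟩ := hspan α hα
  obtain ⟨a', b', rfl⟩ := hspan α' hα'
  obtain ⟨e, f, rfl⟩ := hspan β hβ
  obtain ⟨e', f', rfl⟩ := hspan β' hβ'
  have hdk := h'.deg_k₂
  have hdn := h'.deg_pencil n hn
  have hdm := h'.deg_pencil m hm
  have hdC : ∀ (x : ℝ) {p : ℝ[X]}, p.natDegree ≤ 3 → (C x * p).natDegree ≤ 3 :=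
    fun x p hp => (natDegree_C_mul_le _ _).trans hp
  have hNC : ∀ (x : ℝ) {p : ℝ[X]}, p ∈ N → C x * p ∈ N := fun x p hp => Submodule.C_mul_mem x hp
  -- Both sides express c₃nm in terms of c₁, c₂; replacing c₁ : c₂ by k : n leaves an identity in n,
  -- m, k alone.
  have main : n * ((C a' * n + C b' * m) * k + n * (C e' * n + C f' * m))
      = m * ((C a * n + C b * m) * k + n * (C e * n + C f * m)) := by
    apply mul_left_cancel₀ h'.c₁_ne
    linear_combination k * m * e1 - k * n * e2 +
      (m * (C e * n + C f * m) - n * (C e' * n + C f' * m)) * hk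
  have hb : b = 0 := by
    by_contra hb
    -- Modulo n only b·m²k survives. Coprimality of n and m, used twice, makes bk a constant
    -- multiple of n, although k is independent of N.
    have e3 : n * ((C a' * n + C b' * m) * k + n * (C e' * n + C f' * m) - m * (C a * k)
        - m * (C e * n + C f * m)) = m * (m * (C b * k)) := by linear_combination main
    have hlin : ∀ x y : ℝ, (C x * n + C y * m).natDegree ≤ 3 := fun x y =>
      natDegree_add_le_of_degree_le (hdC x hdn) (hdC y hdm)
    have hdeg : ((C a' * n + C b' * m) * k + n * (C e' * n + C f' * m) - m * (C a * k)
        - m * (C e * n + C f * m)).natDegree ≤ 3 + 3 :=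
      natDegree_sub_le_of_le (natDegree_sub_le_of_le
        (natDegree_add_le_of_degree_le (natDegree_mul_le_six (hlin _ _) hdk)
          (natDegree_mul_le_six hdn (hlin _ _))) (natDegree_mul_le_six hdm (hdC _ hdk)))
        (natDegree_mul_le_six hdm (hlin _ _))
    obtain ⟨q, hq, -, h2⟩ := h'.coprime n hn m hm hind 3 _ _ hdeg
      (natDegree_mul_le_six hdm (hdC _ hdk)) e3
    obtain ⟨z, h3, -⟩ := h'.coprime.exists_const hm hn hind' (hdC b hdk) hq h2
    refine hkN b hb 0 N.zero_mem ?_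
    rw [add_zero, h3, mul_comm]
    exact hNC z hn
  subst hb
  -- With b = 0 a factor n cancels. The remaining cofactors are constant multiples of m and n, which
  -- kills a', b' - a and f in turn.
  have main2 : n * (C a' * k + C e' * n - C (e - f') * m) = m * (C f * m - C (b' - a) * k) := by
    apply mul_left_cancel₀ hn0
    rw [C_sub, C_sub]
    rw [C_0] at main
    linear_combination main
  obtain ⟨z, h1, h2⟩ := h'.coprime.exists_const hn hm hind
    (natDegree_sub_le_of_le (natDegree_add_le_of_degree_le (hdC _ hdk) (hdC _ hdn)) (hdC _ hdm))
    (natDegree_sub_le_of_le (hdC _ hdm) (hdC _ hdk)) main2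
  have ha' : a' = 0 := by
    by_contra ha'
    refine hkN a' ha' (C e' * n - C (e - f') * m) (N.sub_mem (hNC _ hn) (hNC _ hm)) ?_
    rw [← add_sub_assoc, h1, mul_comm]
    exact hNC _ hm
  have hb' : b' - a = 0 := by
    by_contra hb'
    refine hkN _ hb' (-(C f * m)) (N.neg_mem (hNC _ hm)) ?_
    rw [← neg_sub, neg_sub, ← sub_eq_add_neg, ← neg_sub, h2, mul_comm]
    exact N.neg_mem (hNC _ hn)
  rw [hb', C_0] at h2
  have hf := hind z (-f) (by rw [C_neg]; linear_combination -h2)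
  have hf0 : f = 0 := neg_eq_zero.mp hf.2
  refine ⟨a, e, ?_⟩
  apply mul_right_cancel₀ hn0
  rw [hf0, C_0] at e1
  linear_combination e1

/-- If c₃ were a multiple of c₂, then c₂k₁ would lie in V as well as c₂k₂. Decomposing both in c₁N ⊕
c₂N and eliminating the multipliers contradicts the independence of k₁, k₂ modulo N. -/
theorem left_coeff_ne (h : PencilTriple N V k₁ k₂ c₁ c₂ c₃ s t) {x y : ℝ}
    (hc : c₃ = C x * c₁ + C y * c₂) : x ≠ 0 := by
  rintro rfl
  have hy : y ≠ 0 := by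
    rintro rfl
    exact h.c₃_ne (by simp [hc])
  obtain ⟨k₁, k, h', -, α, hα, hk⟩ := h.exists_normalized
  clear h
  have hs : C s⁻¹ * C s = 1 := by rw [← C_mul, inv_mul_cancel₀ h'.s_ne, C_1]
  have hy' : C y⁻¹ * C y = 1 := by rw [← C_mul, inv_mul_cancel₀ hy, C_1]
  have hmem : c₂ * k₁ ∈ V := by
    have h2 : c₂ * k₁ = C s⁻¹ * (C y⁻¹ * (c₃ * (C s * k₁ - C t * k)) + C t * (c₂ * k)) := by
      rw [hc, C_0]
      linear_combination (-(c₂ * k₁) * C y⁻¹ * C y) * hs - (c₂ * k₁ - C s⁻¹ * C t * c₂ * k) * hy'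
    rw [h2]
    exact Submodule.C_mul_mem _ (V.add_mem (Submodule.C_mul_mem _ h'.mem_k₃)
      (Submodule.C_mul_mem _ h'.mem_k₂))
  obtain ⟨a, ha, b, hb, e⟩ := h'.exists_decomp hmem
  have key : α * (k₁ - b) = a * k := by
    apply mul_left_cancel₀ (mul_ne_zero h'.c₁_ne h'.c₂_ne)
    linear_combination α * c₁ * e - a * c₁ * hk
  have hk0 : k ≠ 0 := by
    rintro rfl
    exact h'.swap.k₁_notMem one_ne_zero N.zero_mem (by simp)
  have hα0 : α ≠ 0 := by
    rintro rfl
    simp [h'.c₂_ne, hk0] at hk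
  obtain ⟨m, hm, hind, hspan⟩ := h'.exists_basis hα hα0
  obtain ⟨x, z, rfl⟩ := hspan a ha
  -- If a is a multiple of α, then α cancels in `key` and puts a combination of k₁ and k in N. If
  -- not, coprimality of m and α puts k itself in N.
  by_cases hz : z = 0
  · have : C 1 * k₁ + C (-x) * k ∈ N := by
      have h3 : k₁ - b = C x * k := by
        apply mul_left_cancel₀ hα0
        rw [hz, C_0] at key
        linear_combination key
      have h4 : C 1 * k₁ + C (-x) * k = b := by
        rw [C_1, C_neg]
        linear_combination h3
      rwa [h4]
    exact one_ne_zero (h'.indep_k _ _ this).1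
  · have e5 : m * (C z * k) = α * (k₁ - b - C x * k) := by linear_combination -key
    refine h'.coprime.eq_zero_of_mul_eq hm hα
      (fun x y hxy => (hind y x (by rwa [add_comm])).symm) (fun hmem => ?_)
      ((natDegree_C_mul_le _ _).trans h'.deg_k₂) ?_ e5
    · exact h'.swap.k₁_notMem hz N.zero_mem (by simpa using hmem)
    · exact natDegree_sub_le_of_le (natDegree_sub_le_of_le h'.deg_k₁ (h'.deg_pencil b hb))
        ((natDegree_C_mul_le _ _).trans h'.deg_k₂)

theorem right_coeff_ne (h : PencilTriple N V k₁ k₂ c₁ c₂ c₃ s t) {x y : ℝ}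
    (hc : c₃ = C x * c₁ + C y * c₂) : y ≠ 0 :=
  h.swap.left_coeff_ne (by rw [hc, add_comm])

/-- A factor common to three independent cubics has degree at most one. -/
theorem natDegree_le_one_of_three {u : ℝ[X]} {q : Fin 3 → ℝ[X]}
    (hd : ∀ i, (u * q i).natDegree ≤ 3) (hq : LinearIndependent ℝ q) : u.natDegree ≤ 1 := by
  by_contra hu
  push Not at hu
  have hu0 : u ≠ 0 := by
    rintro rfl
    simp at hu
  have hmem : ∀ i, q i ∈ degreeLT ℝ 2 := by
    intro i
    rw [mem_degreeLT]
    by_cases hqi : q i = 0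
    · rw [hqi, degree_zero]
      exact WithBot.bot_lt_coe _
    · have := hd i
      rw [natDegree_mul hu0 hqi] at this
      rw [← natDegree_lt_iff_degree_lt hqi]
      omega
  have h3 : LinearIndependent ℝ (fun i => (⟨q i, hmem i⟩ : degreeLT ℝ 2)) :=
    LinearIndependent.of_comp (degreeLT ℝ 2).subtype hq
  have : Module.Finite ℝ (degreeLT ℝ 2) := Module.Finite.equiv (degreeLTEquiv ℝ 2).symm
  have h4 := h3.fintype_card_le_finrank
  rw [(degreeLTEquiv ℝ 2).finrank_eq] at h4
  simp at h4

/-- The equation c₁f = c₂g has three independent solutions in cubics: two from the normalization and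
one from the third net. In lowest terms c₁ = qw, c₂ = qu, each has f = ur and g = wr; three
independent r leave degree at most one for u and w. -/
theorem exists_linear_factors (h : PencilTriple N V k₁ k₂ c₁ c₂ c₃ s t) :
    ∃ (q w u : ℝ[X]) (x y : ℝ), q ≠ 0 ∧ w.natDegree ≤ 1 ∧ u.natDegree ≤ 1 ∧ x ≠ 0 ∧ y ≠ 0 ∧
      c₁ = q * w ∧ c₂ = q * u ∧ c₃ = q * (C x * w + C y * u) := by
  obtain ⟨x, y, hc⟩ := h.exists_combination
  have hx := h.left_coeff_ne hc
  have hy := h.right_coeff_ne hc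
  obtain ⟨k₁, k, h', ⟨β, hβ, e1⟩, α, hα, e2⟩ := h.exists_normalized
  clear h
  -- These are the cross terms of c₃(sk₁ - tk) after substituting c₃ = xc₁ + yc₂; the other terms
  -- already lie in V.
  have hmem : c₂ * (C (y * s) * k₁) - c₁ * (C (x * t) * k) ∈ V := by
    have : c₂ * (C (y * s) * k₁) - c₁ * (C (x * t) * k) =
        c₃ * (C s * k₁ - C t * k) - C (x * s) * (c₁ * k₁) + C (y * t) * (c₂ * k) := by
      rw [hc]; simp only [C_mul]; ring
    rw [this]
    exact V.add_mem (V.sub_mem h'.mem_k₃ (Submodule.C_mul_mem _ h'.mem_k₁))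
      (Submodule.C_mul_mem _ h'.mem_k₂)
  obtain ⟨a, ha, b, hb, e⟩ := h'.exists_decomp hmem
  have hk0 : k ≠ 0 := by
    rintro rfl
    exact h'.swap.k₁_notMem one_ne_zero N.zero_mem (by simp)
  have hα0 : α ≠ 0 := by
    rintro rfl
    simp [h'.c₂_ne, hk0] at e2
  obtain ⟨w, u, q, hrel, rfl, rfl⟩ :=
    UniqueFactorizationMonoid.exists_reduced_factors' c₁ c₂ h'.c₂_ne
  have hcop : IsCoprime u w := hrel.isCoprime.symm
  have hq0 : q ≠ 0 := left_ne_zero_of_mul h'.c₁_ne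
  have hu0 : u ≠ 0 := right_ne_zero_of_mul h'.c₂_ne
  have hw0 : w ≠ 0 := right_ne_zero_of_mul h'.c₁_ne
  have key : ∀ f g : ℝ[X], q * w * f = q * u * g → ∃ r, f = u * r ∧ g = w * r := by
    intro f g hfg
    have hfg' : w * f = u * g := mul_left_cancel₀ hq0 (by linear_combination hfg)
    obtain ⟨r, rfl⟩ : u ∣ f := hcop.dvd_of_dvd_mul_left ⟨g, hfg'⟩
    exact ⟨r, rfl, mul_left_cancel₀ hu0 (by linear_combination -hfg')⟩
  obtain ⟨r₁, f1, g1⟩ := key k₁ β e1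
  obtain ⟨r₂, f2, g2⟩ := key α k e2.symm
  obtain ⟨r₃, f3, g3⟩ := key (a + C (x * t) * k) (C (y * s) * k₁ - b) (by linear_combination -e)
  -- A relation among the r's, multiplied by u, is one among k₁, α and a + xt·k. Independence of k₁,
  -- k modulo N clears the coefficients of r₁ and r₃; here xt ≠ 0 matters.
  have hli : LinearIndependent ℝ ![r₁, r₂, r₃] := by
    rw [Fintype.linearIndependent_iff]
    intro g hg
    simp only [Fin.sum_univ_three, smul_eq_C_mul, Matrix.cons_val] at hg
    have h1 : C (g 0) * k₁ + C (g 1) * α + C (g 2) * (a + C (x * t) * k) = 0 := by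
      rw [f1, f2, f3]
      linear_combination u * hg
    have h2 := h'.indep_k (g 0) (g 2 * (x * t)) (by
      have : C (g 0) * k₁ + C (g 2 * (x * t)) * k = -(C (g 1) * α + C (g 2) * a) := by
        rw [C_mul (a := g 2)]
        linear_combination h1
      rw [this]
      exact N.neg_mem (N.add_mem (Submodule.C_mul_mem _ hα) (Submodule.C_mul_mem _ ha)))
    have g2 : g 2 = 0 := (mul_eq_zero.mp h2.2).resolve_right (mul_ne_zero hx h'.t_ne)
    rw [h2.1, g2] at h1
    simp [hα0] at h1
    intro i
    fin_cases i
    exacts [h2.1, h1, g2]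
  have hdC : ∀ (x : ℝ) {p : ℝ[X]}, p.natDegree ≤ 3 → (C x * p).natDegree ≤ 3 :=
    fun x p hp => (natDegree_C_mul_le _ _).trans hp
  refine ⟨q, w, u, x, y, hq0, ?_, ?_, hx, hy, rfl, rfl, by rw [hc]; ring⟩
  · refine natDegree_le_one_of_three (q := ![r₁, r₂, r₃]) (fun i => ?_) hli
    fin_cases i <;> simp only [Matrix.cons_val, Fin.zero_eta, Fin.mk_one, Fin.reduceFinMk]
    · exact g1 ▸ h'.deg_pencil β hβ
    · exact g2 ▸ h'.deg_k₂
    · exact g3 ▸ natDegree_sub_le_of_le (hdC _ h'.deg_k₁) (h'.deg_pencil b hb)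
  · refine natDegree_le_one_of_three (q := ![r₁, r₂, r₃]) (fun i => ?_) hli
    fin_cases i <;> simp only [Matrix.cons_val, Fin.zero_eta, Fin.mk_one, Fin.reduceFinMk]
    · exact f1 ▸ h'.deg_k₁
    · exact f2 ▸ h'.deg_pencil α hα
    · exact f3 ▸ natDegree_add_le_of_degree_le (h'.deg_pencil a ha) (hdC _ h'.deg_k₂)

end PencilTriple

/-! ### Moment vectors, multiplication by linear forms, and cameras in the coordinates of the cubic
-/

/-- The moment vector `(s^d, s^(d-1) t, …, t^d)` over any commutative semiring. -/
def momentVec {R : Type*} [CommSemiring R] (d : ℕ) (s t : R) : Fin (d + 1) → R :=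
  fun k => s ^ (d - (k : ℕ)) * t ^ (k : ℕ)

/-- A complex vector with real entries. -/
noncomputable abbrev complexVec {n : Type*} (v : n → ℝ) : n → ℂ := algebraMap ℝ ℂ ∘ v

/-- The value of the linear form with coefficients `l` at `(s, t)`. -/
noncomputable def linForm {R : Type*} [CommSemiring R] [Algebra ℝ R] (l : Fin 2 → ℝ) (s t : R) : R :=
  algebraMap ℝ R (l 0) * s + algebraMap ℝ R (l 1) * t

/-- The matrix of multiplication of binary cubics by the linear form with coefficients `l`. -/
noncomputable def shiftMatrix (l : Fin 2 → ℝ) : Matrix (Fin 4) (Fin 5) ℝ :=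
  !![l 0, l 1, 0, 0, 0; 0, l 0, l 1, 0, 0; 0, 0, l 0, l 1, 0; 0, 0, 0, l 0, l 1]

theorem shiftMatrix_mulVec_momentVec {R : Type*} [CommRing R] [Algebra ℝ R] (l : Fin 2 → ℝ)
    (s t : R) : (shiftMatrix l).map (algebraMap ℝ R) *ᵥ momentVec 4 s t =
      linForm l s t • momentVec 3 s t := by
  ext k
  fin_cases k <;>
    simp [shiftMatrix, Matrix.mulVec, dotProduct, Fin.sum_univ_five, momentVec, linForm] <;> ring

theorem complexVec_mulVec {m n : Type*} [Fintype n] (A : Matrix m n ℝ) (v : n → ℝ) :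
    A.toComplex *ᵥ complexVec v = complexVec (A *ᵥ v) := by
  ext i
  exact (RingHom.map_mulVec (algebraMap ℝ ℂ) A v i).symm

theorem complexVec_eq_zero {n : Type*} {v : n → ℝ} : complexVec v = 0 ↔ v = 0 := by
  simp [funext_iff]

theorem complexVec_add {n : Type*} (v w : n → ℝ) :
    complexVec (v + w) = complexVec v + complexVec w := by
  ext i; simp

theorem complexVec_smul {n : Type*} (c : ℝ) (v : n → ℝ) :
    complexVec (c • v) = (c : ℂ) • complexVec v := by
  ext i; simp

theorem Matrix.toComplex_mul {l m n : Type*} [Fintype m] (A : Matrix l m ℝ) (B : Matrix m n ℝ) :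
    (A * B).toComplex = A.toComplex * B.toComplex :=
  Matrix.map_mul

theorem Matrix.toComplex_mulVec_mulVec {l m n : Type*} [Fintype m] [Fintype n]
    (A : Matrix l m ℝ) (B : Matrix m n ℝ) (v : n → ℂ) :
    A.toComplex *ᵥ (B.toComplex *ᵥ v) = (A * B).toComplex *ᵥ v := by
  rw [Matrix.toComplex_mul, Matrix.mulVec_mulVec]

theorem Matrix.toComplex_smul {m n : Type*} (c : ℝ) (A : Matrix m n ℝ) :
    (c • A).toComplex = (c : ℂ) • A.toComplex := by
  ext; simp

/-- The quadratic form vanishing at the first two parameters, times s or t, is a cubic form that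
kills the first two vectors. At the third parameter s and t are not both zero, so one of the two
cubics detects it. -/
theorem momentVec_three_indep {s₁ t₁ s₂ t₂ s₃ t₃ x y z : ℂ} (h₁₃ : s₃ * t₁ - t₃ * s₁ ≠ 0)
    (h₂₃ : s₃ * t₂ - t₃ * s₂ ≠ 0)
    (h : x • momentVec 3 s₁ t₁ + y • momentVec 3 s₂ t₂ + z • momentVec 3 s₃ t₃ = 0) : z = 0 := by
  have e0 := congrFun h 0
  have e1 := congrFun h 1
  have e2 := congrFun h 2
  have e3 := congrFun h 3
  simp [momentVec] at e0 e1 e2 e3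
  have hs : z * s₃ * ((s₃ * t₁ - t₃ * s₁) * (s₃ * t₂ - t₃ * s₂)) = 0 := by
    linear_combination t₁ * t₂ * e0 - (t₁ * s₂ + s₁ * t₂) * e1 + s₁ * s₂ * e2
  have ht : z * t₃ * ((s₃ * t₁ - t₃ * s₁) * (s₃ * t₂ - t₃ * s₂)) = 0 := by
    linear_combination t₁ * t₂ * e1 - (t₁ * s₂ + s₁ * t₂) * e2 + s₁ * s₂ * e3
  have hd := mul_ne_zero h₁₃ h₂₃
  have hs' := (mul_eq_zero.mp hs).resolve_right hd
  have ht' := (mul_eq_zero.mp ht).resolve_right hd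
  by_contra hz
  rw [mul_eq_zero, or_iff_right hz] at hs' ht'
  simp [hs', ht'] at h₁₃

/-- Three cameras with distinct collinear centers, spanned by `b i`, on a line that does not
meet the standard twisted cubic. -/
structure CollinearCameras (M : Fin 3 → Matrix (Fin 3) (Fin 4) ℝ) (b : Fin 3 → Fin 4 → ℝ) :
    Prop where
  right_inv : ∀ i, ∃ G : Matrix (Fin 4) (Fin 3) ℝ, M i * G = 1
  mulVec_center : ∀ i, M i *ᵥ b i = 0
  ker : ∀ i (v : Fin 4 → ℂ), (M i).toComplex *ᵥ v = 0 → ∃ c : ℂ, v = c • complexVec (b i)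
  indep : ∀ i j, i ≠ j → ∀ x y : ℝ, x • b i + y • b j = 0 → x = 0 ∧ y = 0
  collinear : ∀ i j k, i ≠ j → i ≠ k → j ≠ k →
    ∃ s t : ℝ, s ≠ 0 ∧ t ≠ 0 ∧ b k = s • b i + t • b j
  disjoint : ∀ i j (s t : ℂ), (s ≠ 0 ∨ t ≠ 0) → ∀ x y : ℂ,
    momentVec 3 s t ≠ x • complexVec (b i) + y • complexVec (b j)

namespace CollinearCameras

variable {M : Fin 3 → Matrix (Fin 3) (Fin 4) ℝ} {b : Fin 3 → Fin 4 → ℝ}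

theorem mulVec_momentVec_ne_zero (h : CollinearCameras M b) (i : Fin 3) {s t : ℂ}
    (hst : s ≠ 0 ∨ t ≠ 0) : (M i).toComplex *ᵥ momentVec 3 s t ≠ 0 := by
  intro h0
  obtain ⟨c, hc⟩ := h.ker i _ h0
  exact h.disjoint i i s t hst c 0 (by rw [hc, zero_smul, add_zero])

theorem ker_real (h : CollinearCameras M b) (i : Fin 3) {v : Fin 4 → ℝ} (hv : M i *ᵥ v = 0) :
    ∃ c : ℝ, v = c • b i := by
  obtain ⟨c, hc⟩ := h.ker i (complexVec v) (by rw [complexVec_mulVec, hv]; ext; simp)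
  refine ⟨c.re, ?_⟩
  ext k
  have := congrArg Complex.re (congrFun hc k)
  simpa using this

theorem exists_vecMul_eq (h : CollinearCameras M b) (i : Fin 3) {v : Fin 4 → ℝ}
    (hv : v ⬝ᵥ b i = 0) : ∃ u : Fin 3 → ℝ, v = u ᵥ* M i := by
  obtain ⟨G, hG⟩ := h.right_inv i
  refine ⟨v ᵥ* G, ?_⟩
  refine dotProduct_eq _ _ fun w => ?_
  obtain ⟨c, hc⟩ := h.ker_real i (v := w - G *ᵥ (M i *ᵥ w)) (by
    rw [Matrix.mulVec_sub, Matrix.mulVec_mulVec, hG, Matrix.one_mulVec, sub_self])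
  have : v ⬝ᵥ (w - G *ᵥ (M i *ᵥ w)) = 0 := by rw [hc, dotProduct_smul, hv, smul_zero]
  rw [dotProduct_sub, sub_eq_zero] at this
  rw [this, Matrix.dotProduct_mulVec, Matrix.dotProduct_mulVec]

theorem center_ne_zero (h : CollinearCameras M b) (i : Fin 3) : b i ≠ 0 := by
  intro hb
  obtain ⟨j, hj⟩ := exists_ne i
  have := (h.indep i j hj.symm 1 0 (by simp [hb])).1
  exact one_ne_zero this

/-- No camera maps three distinct points of the twisted cubic to the same image point. -/
theorem not_three_on_ray (h : CollinearCameras M b) (i : Fin 3) {s₁ t₁ s₂ t₂ s₃ t₃ x y : ℂ}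
    (h₁₂ : s₂ * t₁ - t₂ * s₁ ≠ 0) (h₁₃ : s₃ * t₁ - t₃ * s₁ ≠ 0) (h₂₃ : s₃ * t₂ - t₃ * s₂ ≠ 0)
    (h₂ : (M i).toComplex *ᵥ momentVec 3 s₂ t₂ = x • (M i).toComplex *ᵥ momentVec 3 s₁ t₁)
    (h₃ : (M i).toComplex *ᵥ momentVec 3 s₃ t₃ = y • (M i).toComplex *ᵥ momentVec 3 s₁ t₁) :
    False := by
  obtain ⟨c, hc⟩ := h.ker i (momentVec 3 s₂ t₂ - x • momentVec 3 s₁ t₁) (by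
    rw [Matrix.mulVec_sub, Matrix.mulVec_smul, h₂, sub_self])
  obtain ⟨c', hc'⟩ := h.ker i (momentVec 3 s₃ t₃ - y • momentVec 3 s₁ t₁) (by
    rw [Matrix.mulVec_sub, Matrix.mulVec_smul, h₃, sub_self])
  -- Eliminating the center from `hc` and `hc'` gives a linear relation among three points of the
  -- cubic.
  have hc0 : c = 0 := by
    refine momentVec_three_indep (x := c' * x - c * y) (y := -c') (z := c) h₁₃ h₂₃ ?_
    have h1 : c • (momentVec 3 s₃ t₃ - y • momentVec 3 s₁ t₁) = c • c' • complexVec (b i) := by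
      rw [hc']
    have h2 : c' • (momentVec 3 s₂ t₂ - x • momentVec 3 s₁ t₁) = c' • c • complexVec (b i) := by
      rw [hc]
    rw [smul_comm c c', ← h2, ← sub_eq_zero] at h1
    rw [← h1]
    module
  rw [hc0, zero_smul, sub_eq_zero] at hc
  refine one_ne_zero (momentVec_three_indep (x := -x) (y := 0) (z := 1) h₁₂ h₁₂ ?_)
  rw [hc]
  module

end CollinearCameras

/-! ### Quartic models and their fibers -/

/-- `Q` views the quartic parametrized by `B` as `M` views the standard twisted cubic, the
parametrizations of the images differing by the linear forms `l i`. -/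
structure QuarticModel (M Q : Fin 3 → Matrix (Fin 3) (Fin 4) ℝ) (B : Matrix (Fin 4) (Fin 5) ℝ)
    (l : Fin 3 → Fin 2 → ℝ) : Prop where
  mul_eq : ∀ i, Q i * B = M i * shiftMatrix (l i)
  rows : LinearIndependent ℝ B.row
  indep : ∀ i j, i ≠ j → l i 0 * l j 1 - l i 1 * l j 0 ≠ 0

namespace QuarticModel

variable {M Q : Fin 3 → Matrix (Fin 3) (Fin 4) ℝ} {B : Matrix (Fin 4) (Fin 5) ℝ}
  {l : Fin 3 → Fin 2 → ℝ} {b : Fin 3 → Fin 4 → ℝ}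

theorem mulVec_eq (h : QuarticModel M Q B l) (i : Fin 3) (s t : ℂ) :
    (Q i).toComplex *ᵥ (B.toComplex *ᵥ momentVec 4 s t) =
      linForm (l i) s t • (M i).toComplex *ᵥ momentVec 3 s t := by
  rw [Matrix.toComplex_mulVec_mulVec, h.mul_eq, ← Matrix.toComplex_mulVec_mulVec,
    shiftMatrix_mulVec_momentVec, Matrix.mulVec_smul]

theorem eq_zero_of_linForm (h : QuarticModel M Q B l) {i j : Fin 3} (hij : i ≠ j) {s t : ℂ}
    (hi : linForm (l i) s t = 0) (hj : linForm (l j) s t = 0) : s = 0 ∧ t = 0 := by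
  have hd : ((l i 0 : ℂ) * l j 1 - l i 1 * l j 0) ≠ 0 := by exact_mod_cast h.indep i j hij
  simp only [linForm, Complex.coe_algebraMap] at hi hj
  constructor
  · refine (mul_eq_zero.mp ?_).resolve_left hd
    linear_combination (l j 1 : ℂ) * hi - (l i 1 : ℂ) * hj
  · refine (mul_eq_zero.mp ?_).resolve_left hd
    linear_combination (l i 0 : ℂ) * hj - (l j 0 : ℂ) * hi

theorem mulVec_momentVec_ne_zero (h : QuarticModel M Q B l) (hM : CollinearCameras M b) {s t : ℂ}
    (hst : s ≠ 0 ∨ t ≠ 0) : B.toComplex *ᵥ momentVec 4 s t ≠ 0 := by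
  intro h0
  have hl : ∀ i, linForm (l i) s t = 0 := by
    intro i
    have := h.mulVec_eq i s t
    rw [h0, Matrix.mulVec_zero, eq_comm, smul_eq_zero] at this
    exact this.resolve_right (hM.mulVec_momentVec_ne_zero i hst)
  have := h.eq_zero_of_linForm (i := 0) (j := 1) (by decide) (hl 0) (hl 1)
  simp [this] at hst

theorem linForm_root (l : Fin 2 → ℝ) : linForm l (l 1 : ℂ) (-l 0 : ℂ) = 0 := by
  simp [linForm]; ring

theorem root_ne_zero (h : QuarticModel M Q B l) (i : Fin 3) :
    (l i 1 : ℂ) ≠ 0 ∨ (-l i 0 : ℂ) ≠ 0 := by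
  obtain ⟨j, hj⟩ := exists_ne i
  have := h.indep i j hj.symm
  by_contra! hc
  have h1 : l i 1 = 0 := by exact_mod_cast hc.1
  have h0 : l i 0 = 0 := by exact_mod_cast neg_eq_zero.mp hc.2
  simp [h0, h1] at this

theorem linForm_root_ne (h : QuarticModel M Q B l) {i j : Fin 3} (hij : i ≠ j) :
    linForm (l j) (l i 1 : ℂ) (-l i 0 : ℂ) ≠ 0 := by
  intro h0
  have h1 := h.eq_zero_of_linForm hij (linForm_root (l i)) h0
  have := h.root_ne_zero i
  simp_all

theorem mulVec_root (h : QuarticModel M Q B l) (i : Fin 3) :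
    (Q i).toComplex *ᵥ (B.toComplex *ᵥ momentVec 4 (l i 1 : ℂ) (-l i 0 : ℂ)) = 0 := by
  rw [h.mulVec_eq, linForm_root, zero_smul]

theorem exists_distinct (h : QuarticModel M Q B l) {s t : ℂ} (hst : s ≠ 0 ∨ t ≠ 0) :
    ∃ i j k : Fin 3, i ≠ j ∧ i ≠ k ∧ j ≠ k ∧ linForm (l j) s t ≠ 0 ∧ linForm (l k) s t ≠ 0 := by
  have hne : ∀ i j, i ≠ j → linForm (l i) s t = 0 → linForm (l j) s t ≠ 0 := by
    intro i j hij hi hj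
    have := h.eq_zero_of_linForm hij hi hj
    simp [this] at hst
  by_cases h0 : linForm (l 0) s t = 0
  · exact ⟨0, 1, 2, by decide, by decide, by decide, hne 0 1 (by decide) h0,
      hne 0 2 (by decide) h0⟩
  by_cases h1 : linForm (l 1) s t = 0
  · exact ⟨1, 0, 2, by decide, by decide, by decide, h0, hne 1 2 (by decide) h1⟩
  · exact ⟨2, 0, 1, by decide, by decide, by decide, h0, h1⟩

/-- A point that the cameras `Q` see as `M` sees a point of the cubic is on the quartic. -/
theorem eq_smul_of_mulVec (h : QuarticModel M Q B l) (hM : CollinearCameras M b)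
    (hQ : ∀ i, ∃ d : Fin 4 → ℂ, ∀ v, (Q i).toComplex *ᵥ v = 0 → ∃ c : ℂ, v = c • d)
    {s t : ℂ} (hst : s ≠ 0 ∨ t ≠ 0) {y : Fin 4 → ℂ}
    (hy : ∀ i, ∃ c : ℂ, (Q i).toComplex *ᵥ y = c • (M i).toComplex *ᵥ momentVec 3 s t) :
    ∃ c : ℂ, y = c • B.toComplex *ᵥ momentVec 4 s t := by
  have hker : ∀ i v, (Q i).toComplex *ᵥ v = 0 →
      ∃ c : ℂ, v = c • B.toComplex *ᵥ momentVec 4 (l i 1 : ℂ) (-l i 0 : ℂ) := by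
    intro i v hv
    obtain ⟨d, hd⟩ := hQ i
    obtain ⟨c, rfl⟩ := hd v hv
    obtain ⟨c', hc'⟩ := hd _ (h.mulVec_root i)
    have hc0 : c' ≠ 0 := by
      rintro rfl
      exact h.mulVec_momentVec_ne_zero hM (h.root_ne_zero i) (by rw [hc', zero_smul])
    exact ⟨c * c'⁻¹, by rw [hc', smul_smul, mul_assoc, inv_mul_cancel₀ hc0, mul_one]⟩
  choose γ hγ using hy
  -- At most one of the forms vanishes at (s, t), so j and k can be chosen where theirs do not; i is
  -- the remaining camera.
  obtain ⟨i, j, k, hij, hik, hjk, hj, hk⟩ := h.exists_distinct hst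
  by_contra hne
  -- If y is off the curve point, a combination of the two is a nonzero multiple of the center of
  -- Q_j, which is the quartic point at the root of l_j. Applying Q_i shows that M_i sees the cubic
  -- at that root and at (s, t) alike. Doing this for j and k puts three points on one ray.
  have step : ∀ j, i ≠ j → linForm (l j) s t ≠ 0 → ∃ x : ℂ,
      (M i).toComplex *ᵥ momentVec 3 (l j 1 : ℂ) (-l j 0 : ℂ) =
        x • (M i).toComplex *ᵥ momentVec 3 s t := by
    intro j hij hj
    obtain ⟨c, hc⟩ := hker j (linForm (l j) s t • y - γ j • B.toComplex *ᵥ momentVec 4 s t) (by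
      rw [Matrix.mulVec_sub, Matrix.mulVec_smul, Matrix.mulVec_smul, hγ, h.mulVec_eq, smul_smul,
        smul_smul, mul_comm, sub_self])
    have hc0 : c ≠ 0 := by
      rintro rfl
      rw [zero_smul, sub_eq_zero] at hc
      refine hne ⟨(linForm (l j) s t)⁻¹ * γ j, ?_⟩
      rw [← smul_smul, ← hc, smul_smul, inv_mul_cancel₀ hj, one_smul]
    have h2 := congrArg ((Q i).toComplex *ᵥ ·) hc
    simp only [Matrix.mulVec_sub, Matrix.mulVec_smul, hγ, h.mulVec_eq, smul_smul] at h2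
    rw [← sub_smul] at h2
    have hu := mul_ne_zero hc0 (h.linForm_root_ne hij.symm)
    refine ⟨(c * linForm (l i) (l j 1 : ℂ) (-l j 0 : ℂ))⁻¹ *
      (linForm (l j) s t * γ i - γ j * linForm (l i) s t), ?_⟩
    rw [← smul_smul, h2, smul_smul, inv_mul_cancel₀ hu, one_smul]
  obtain ⟨x, hx⟩ := step j hij hj
  obtain ⟨x', hx'⟩ := step k hik hk
  refine hM.not_three_on_ray i ?_ ?_ ?_ hx hx'
  · intro h0
    apply hj
    simp only [linForm, Complex.coe_algebraMap]
    linear_combination h0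
  · intro h0
    apply hk
    simp only [linForm, Complex.coe_algebraMap]
    linear_combination h0
  · have := h.indep j k hjk
    have hd : ((l j 0 : ℂ) * l k 1 - l j 1 * l k 0) ≠ 0 := by exact_mod_cast this
    intro h0
    apply hd
    linear_combination -h0

end QuarticModel

/-! ### Camera kernels and reduction to the standard twisted cubic -/

/-- The kernel of a camera is spanned by a real vector. -/
theorem Camera.exists_kernel (P : Camera) : ∃ b : Fin 4 → ℝ, b ≠ 0 ∧ P.mat *ᵥ b = 0 ∧
    ∀ v : Fin 4 → ℂ, P.mat.toComplex *ᵥ v = 0 → ∃ c : ℂ, v = c • complexVec b := by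
  have hker : LinearMap.ker P.mat.mulVecLin ≠ ⊥ :=
    LinearMap.ker_ne_bot_of_finrank_lt (by simp)
  obtain ⟨b, hb, hb0⟩ := Submodule.exists_mem_ne_zero_of_ne_bot hker
  have hb' : P.mat *ᵥ b = 0 := hb
  refine ⟨b, hb0, hb', fun v hv => ?_⟩
  have hbc : P.mat.toComplex *ᵥ complexVec b = 0 := by
    rw [complexVec_mulVec, hb', complexVec_eq_zero]
  obtain ⟨c, hc⟩ := (finrank_eq_one_iff_of_nonzero'
    (⟨complexVec b, hbc⟩ : LinearMap.ker P.mat.toComplex.mulVecLin)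
    (fun h => hb0 (complexVec_eq_zero.mp (congrArg Subtype.val h)))).mp P.finrank_ker ⟨v, hv⟩
  exact ⟨c, (congrArg Subtype.val hc).symm⟩

theorem Camera.exists_right_inv (P : Camera) : ∃ G : Matrix (Fin 4) (Fin 3) ℝ, P.mat * G = 1 := by
  have hs : LinearMap.range P.mat.mulVecLin = ⊤ := by
    apply Submodule.eq_top_of_finrank_eq
    have h := P.full_rank
    rw [Matrix.rank] at h
    rw [h]; simp
  exact Matrix.mulVec_surjective_iff_exists_right_inverse.mp (LinearMap.range_eq_top.mp hs)

theorem Camera.submodule_center (P : Camera) :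
    P.center.submodule = LinearMap.ker P.mat.toComplex.mulVecLin :=
  Projectivization.submodule_mk'' _ _

theorem Camera.center_eq_mk (P : Camera) {v : Fin 4 → ℂ} (hv : v ≠ 0)
    (h : P.mat.toComplex *ᵥ v = 0) : P.center = Projectivization.mk ℂ v hv := by
  apply Projectivization.submodule_injective
  rw [P.submodule_center, Projectivization.submodule_mk]
  symm
  apply Submodule.eq_of_le_of_finrank_eq
  · rw [Submodule.span_singleton_le_iff_mem]
    exact h
  · rw [P.finrank_ker, finrank_span_singleton hv]

theorem projectivization_mk_eq {n : ℕ} {v w : Fin n → ℂ} (hv : v ≠ 0) (hw : w ≠ 0) {c : ℂ}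
    (h : v = c • w) : Projectivization.mk ℂ v hv = Projectivization.mk ℂ w hw := by
  rw [Projectivization.mk_eq_mk_iff']
  exact ⟨c, h.symm⟩

theorem CameraTuple.sees_mk {n : ℕ} (P : CameraTuple n) {v : Fin 4 → ℂ} (hv : v ≠ 0)
    (z : Fin n → Image) : P.Sees (Projectivization.mk ℂ v hv) z ↔
      ∀ i, ∃ c : ℂ, (P.cam i).mat.toComplex *ᵥ v = c • (z i).rep := by
  obtain ⟨a, ha⟩ := Projectivization.exists_smul_eq_mk_rep ℂ v hv
  refine forall_congr' fun i => ?_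
  rw [← ha, Units.smul_def, Matrix.mulVec_smul]
  constructor
  · rintro ⟨c, hc⟩
    refine ⟨(a : ℂ)⁻¹ * c, ?_⟩
    rw [← smul_smul, ← hc, smul_smul, inv_mul_cancel₀ a.ne_zero, one_smul]
  · rintro ⟨c, hc⟩
    exact ⟨a * c, by rw [hc, smul_smul]⟩

theorem complexVec_pair_eq_zero {b₁ b₂ : Fin 4 → ℝ}
    (h : ∀ x y : ℝ, x • b₁ + y • b₂ = 0 → x = 0 ∧ y = 0) {x y : ℂ}
    (hxy : x • complexVec b₁ + y • complexVec b₂ = 0) : x = 0 ∧ y = 0 := by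
  have hre := h x.re y.re (by
    ext k
    simpa using congrArg Complex.re (congrFun hxy k))
  have him := h x.im y.im (by
    ext k
    simpa using congrArg Complex.im (congrFun hxy k))
  exact ⟨Complex.ext hre.1 him.1, Complex.ext hre.2 him.2⟩

theorem exists_real_combination {b₁ b₂ b₃ : Fin 4 → ℝ} {x y : ℂ}
    (hxy : complexVec b₃ = x • complexVec b₁ + y • complexVec b₂) :
    b₃ = x.re • b₁ + y.re • b₂ := by
  ext k
  simpa using congrArg Complex.re (congrFun hxy k)

/-- Cameras on a line missing a twisted cubic, in the coordinates of the cubic. -/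
theorem exists_collinearCameras (P : CameraTuple 3) (L C : Set Space)
    (hL : IsLine L) (hPL : ∀ i, (P.cam i).center ∈ L)
    (hC : IsTwistedCubic C) (hdisj : Disjoint C L) :
    ∃ (A A' : Matrix (Fin 4) (Fin 4) ℝ) (b : Fin 3 → Fin 4 → ℝ), A * A' = 1 ∧
      CollinearCameras (fun i => (P.cam i).mat * A) b ∧
      C = {x | ∃ (s t : ℂ) (h : A.toComplex *ᵥ momentVec 3 s t ≠ 0),
        (s ≠ 0 ∨ t ≠ 0) ∧ x = Projectivization.mk ℂ _ h} := by
  obtain ⟨A, hA, hA0, hCA⟩ := hC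
  obtain ⟨W, hW, rfl⟩ := hL
  change Matrix (Fin 4) (Fin 4) ℝ at A
  obtain ⟨u, rfl⟩ : IsUnit A := Matrix.linearIndependent_rows_iff_isUnit.mp hA
  set A : Matrix (Fin 4) (Fin 4) ℝ := ↑u
  set A' : Matrix (Fin 4) (Fin 4) ℝ := ↑u⁻¹
  have hAA' : A * A' = 1 := u.mul_inv
  have hA'A : A' * A = 1 := u.inv_mul
  have hAinj : ∀ v : Fin 4 → ℂ, A.toComplex *ᵥ v = 0 → v = 0 := by
    intro v hv
    have := congrArg (A'.toComplex *ᵥ ·) hv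
    simp only [Matrix.toComplex_mulVec_mulVec, hA'A, Matrix.mulVec_zero] at this
    simpa [Matrix.toComplex] using this
  have hrank : ∀ i, ((P.cam i).mat * A).rank = 3 := by
    intro i
    rw [Matrix.rank_mul_eq_left_of_isUnit_det _ _ ((Matrix.isUnit_iff_isUnit_det _).mp u.isUnit)]
    exact (P.cam i).full_rank
  let K : Fin 3 → Camera := fun i => ⟨(P.cam i).mat * A, hrank i⟩
  choose b hb0 hb hker using fun i => (K i).exists_kernel
  have hcen0 : ∀ i, A.toComplex *ᵥ complexVec (b i) ≠ 0 := fun i h0 =>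
    hb0 i (complexVec_eq_zero.mp (hAinj _ h0))
  have hcen : ∀ i, (P.cam i).center = Projectivization.mk ℂ _ (hcen0 i) := by
    intro i
    apply Camera.center_eq_mk
    rw [Matrix.toComplex_mulVec_mulVec]
    change (K i).mat.toComplex *ᵥ _ = 0
    rw [complexVec_mulVec, hb, complexVec_eq_zero]
  have hmem : ∀ i, A.toComplex *ᵥ complexVec (b i) ∈ W := by
    intro i
    have := hPL i
    rw [hcen i] at this
    simpa [Projectivization.submodule_mk] using this
  have hindep : ∀ i j, i ≠ j → ∀ x y : ℝ, x • b i + y • b j = 0 → x = 0 ∧ y = 0 := by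
    intro i j hij x y hxy
    have hx : x = 0 := by
      by_contra hx
      apply hij
      apply P.distinct_centers
      simp only [hcen]
      refine projectivization_mk_eq _ _ (c := ((-(x⁻¹ * y) : ℝ) : ℂ)) ?_
      rw [← Matrix.mulVec_smul, ← complexVec_smul]
      congr 2
      have := congrArg (fun v => x⁻¹ • v) hxy
      simp only [smul_add, smul_smul, inv_mul_cancel₀ hx, one_smul, smul_zero] at this
      rw [neg_smul]
      exact eq_neg_of_add_eq_zero_left this
    subst hx
    rw [zero_smul, zero_add, smul_eq_zero] at hxy
    exact ⟨rfl, hxy.resolve_right (hb0 j)⟩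
  refine ⟨A, A', b, hAA', ⟨fun i => (K i).exists_right_inv, hb, hker, hindep, ?_, ?_⟩, hCA⟩
  · intro i j k hij hik hjk
    have hli : LinearIndependent ℂ (![⟨_, hmem i⟩, ⟨_, hmem j⟩] : Fin 2 → W) := by
      rw [LinearIndependent.pair_iff]
      intro x y hxy
      have h1 : x • A.toComplex *ᵥ complexVec (b i) + y • A.toComplex *ᵥ complexVec (b j) = 0 :=
        congrArg Subtype.val hxy
      rw [← Matrix.mulVec_smul, ← Matrix.mulVec_smul, ← Matrix.mulVec_add] at h1
      exact complexVec_pair_eq_zero (hindep i j hij) (hAinj _ h1)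
    have htop := hli.span_eq_top_of_card_eq_finrank (by simp [hW])
    have hk : (⟨_, hmem k⟩ : W) ∈ Submodule.span ℂ
        (Set.range (![⟨_, hmem i⟩, ⟨_, hmem j⟩] : Fin 2 → W)) := by
      rw [htop]; trivial
    rw [Matrix.range_cons, Matrix.range_cons, Matrix.range_empty, Set.union_empty,
      Set.singleton_union, Submodule.mem_span_pair] at hk
    obtain ⟨x, y, hxy⟩ := hk
    have h1 : x • A.toComplex *ᵥ complexVec (b i) + y • A.toComplex *ᵥ complexVec (b j) =
      A.toComplex *ᵥ complexVec (b k) := congrArg Subtype.val hxy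
    rw [← Matrix.mulVec_smul, ← Matrix.mulVec_smul, ← Matrix.mulVec_add, eq_comm, ← sub_eq_zero,
      ← Matrix.mulVec_sub] at h1
    have h2 := exists_real_combination (sub_eq_zero.mp (hAinj _ h1))
    refine ⟨x.re, y.re, fun hx => ?_, fun hy => ?_, h2⟩
    · rw [hx, zero_smul, zero_add] at h2
      exact one_ne_zero (hindep k j hjk.symm 1 (-y.re) (by rw [h2]; module)).1
    · rw [hy, zero_smul, add_zero] at h2
      exact one_ne_zero (hindep k i hik.symm 1 (-x.re) (by rw [h2]; module)).1
  · intro i j s t hst x y heq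
    have h0 := hA0 s t hst
    refine Set.disjoint_left.mp hdisj (?_ : Projectivization.mk ℂ _ h0 ∈ C) ?_
    · rw [hCA]
      exact ⟨s, t, h0, hst, rfl⟩
    · simp only [Set.mem_ofPred_eq, Projectivization.submodule_mk,
        Submodule.span_singleton_le_iff_mem]
      change A.toComplex *ᵥ momentVec 3 s t ∈ W
      rw [heq, Matrix.mulVec_add, Matrix.mulVec_smul, Matrix.mulVec_smul]
      exact W.add_mem (W.smul_mem _ (hmem i)) (W.smul_mem _ (hmem j))

/-! ### Construction of a quartic model -/

/-- B is the projection from the point φ of 4-space: its rows are a basis of the hyperplane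
orthogonal to φ, so every matrix that kills φ factors through B. -/
theorem exists_rows_orthogonal {φ : Fin 5 → ℝ} (hφ : φ ≠ 0) :
    ∃ B : Matrix (Fin 4) (Fin 5) ℝ, LinearIndependent ℝ B.row ∧
      ∀ w, w ⬝ᵥ φ = 0 → ∃ u, w = u ᵥ* B := by
  let f : Module.Dual ℝ (Fin 5 → ℝ) :=
    { toFun := fun w => w ⬝ᵥ φ
      map_add' := fun v w => add_dotProduct v w φ
      map_smul' := fun c v => smul_dotProduct c v φ }
  have hf : f ≠ 0 := by
    intro h0
    have : φ ⬝ᵥ φ = 0 := LinearMap.congr_fun h0 φ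
    exact hφ (dotProduct_self_eq_zero.mp this)
  have hrank : Module.finrank ℝ (LinearMap.ker f) = 4 := by
    have := Module.Dual.finrank_ker_add_one_of_ne_zero hf
    simp at this
    exact this
  let e := Module.finBasisOfFinrankEq ℝ (LinearMap.ker f) hrank
  refine ⟨Matrix.of fun i => (e i : Fin 5 → ℝ), ?_, fun w hw => ?_⟩
  · exact e.linearIndependent.map' (LinearMap.ker f).subtype (Submodule.ker_subtype _)
  · refine ⟨e.repr ⟨w, hw⟩, ?_⟩
    have : ((∑ i, e.repr ⟨w, hw⟩ i • e i : LinearMap.ker f) : Fin 5 → ℝ) = w :=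
      congrArg Subtype.val (e.sum_repr ⟨w, hw⟩)
    refine this.symm.trans ?_
    rw [Matrix.vecMul_eq_sum, Submodule.coe_sum]
    rfl

theorem shiftMatrix_mulVec_succ (l : Fin 2 → ℝ) (φ : Fin 5 → ℝ) (k : Fin 4) :
    (shiftMatrix l *ᵥ φ) k = l 0 * φ k.castSucc + l 1 * φ k.succ := by
  fin_cases k <;> simp [shiftMatrix, Matrix.mulVec, dotProduct, Fin.sum_univ_five]

/-- The line through `b₁` and `b₂` is spanned by the two windows of length four of a vector of
length five. -/
theorem exists_windows (b₁ b₂ : Fin 4 → ℝ) : ∃ α β γ δ : ℝ, ¬ (α = 0 ∧ β = 0 ∧ γ = 0 ∧ δ = 0) ∧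
    ∃ φ : Fin 5 → ℝ, (∀ k : Fin 4, φ k.castSucc = α * b₁ k + β * b₂ k) ∧
      ∀ k : Fin 4, φ k.succ = γ * b₁ k + δ * b₂ k := by
  -- The two windows overlap in three entries: three linear conditions on the four unknowns α, β, γ,
  -- δ.
  let T : Matrix (Fin 3) (Fin 4) ℝ :=
    Matrix.of fun k => ![b₁ k.succ, b₂ k.succ, -b₁ k.castSucc, -b₂ k.castSucc]
  have hker : LinearMap.ker T.mulVecLin ≠ ⊥ := LinearMap.ker_ne_bot_of_finrank_lt (by simp)
  obtain ⟨g, hg, hg0⟩ := Submodule.exists_mem_ne_zero_of_ne_bot hker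
  have hg' : T *ᵥ g = 0 := hg
  refine ⟨g 0, g 1, g 2, g 3, fun h => hg0 ?_,
    Fin.snoc (fun k => g 0 * b₁ k + g 1 * b₂ k) (g 2 * b₁ 3 + g 3 * b₂ 3), fun k => ?_, fun k => ?_⟩
  · ext k
    fin_cases k <;> simp [h]
  · rw [Fin.snoc_castSucc]
  · have h0 := congrFun hg' 0
    have h1 := congrFun hg' 1
    have h2 := congrFun hg' 2
    simp [T, Matrix.mulVec, dotProduct, Fin.sum_univ_four] at h0 h1 h2
    fin_cases k
    · change g 0 * b₁ 1 + g 1 * b₂ 1 = g 2 * b₁ 0 + g 3 * b₂ 0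
      linear_combination h0
    · change g 0 * b₁ 2 + g 1 * b₂ 2 = g 2 * b₁ 1 + g 3 * b₂ 1
      linear_combination h1
    · change g 0 * b₁ 3 + g 1 * b₂ 3 = g 2 * b₁ 2 + g 3 * b₂ 2
      linear_combination h2
    · rfl

namespace CollinearCameras

variable {M : Fin 3 → Matrix (Fin 3) (Fin 4) ℝ} {b : Fin 3 → Fin 4 → ℝ}

theorem momentVec_ne_real (h : CollinearCameras M b) (i j : Fin 3) {s t x y : ℝ}
    (hst : s ≠ 0 ∨ t ≠ 0) : momentVec 3 s t ≠ x • b i + y • b j := by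
  intro heq
  refine h.disjoint i j s t (by exact_mod_cast hst) x y ?_
  rw [← complexVec_smul, ← complexVec_smul, ← complexVec_add, ← heq]
  ext k
  simp [momentVec]

/-- Dependent windows mean a first-order linear recurrence for φ, hence a geometric progression. A
nonzero window of it is a point of the twisted cubic on the line of centers. -/
theorem windows_det_ne_zero (h : CollinearCameras M b) {i j : Fin 3} (hij : i ≠ j)
    {α β γ δ : ℝ} (h0 : ¬ (α = 0 ∧ β = 0 ∧ γ = 0 ∧ δ = 0)) {φ : Fin 5 → ℝ}
    (h1 : ∀ k : Fin 4, φ k.castSucc = α * b i k + β * b j k)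
    (h2 : ∀ k : Fin 4, φ k.succ = γ * b i k + δ * b j k) : α * δ - β * γ ≠ 0 := by
  intro hD
  have hφ : φ ≠ 0 := by
    rintro rfl
    have e1 := h.indep i j hij α β (by ext k; simpa [eq_comm] using h1 k)
    have e2 := h.indep i j hij γ δ (by ext k; simpa [eq_comm] using h2 k)
    exact h0 ⟨e1.1, e1.2, e2.1, e2.2⟩
  obtain ⟨x, y, hxy, hx, hy⟩ : ∃ x y : ℝ, ¬ (x = 0 ∧ y = 0) ∧ x * α + y * γ = 0 ∧
      x * β + y * δ = 0 := by
    by_cases hαγ : γ = 0 ∧ -α = 0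
    · refine ⟨δ, -β, fun hc => h0 ⟨neg_eq_zero.mp hαγ.2, neg_eq_zero.mp hc.2, hαγ.1, hc.1⟩,
        by linear_combination hD, by ring⟩
    · exact ⟨γ, -α, hαγ, by ring, by linear_combination -hD⟩
  have hrec : ∀ k : Fin 4, x * φ k.castSucc + y * φ k.succ = 0 := by
    intro k
    rw [h1, h2]
    linear_combination b i k * hx + b j k * hy
  have r0 : x * φ 0 + y * φ 1 = 0 := hrec 0
  have r1 : x * φ 1 + y * φ 2 = 0 := hrec 1
  have r2 : x * φ 2 + y * φ 3 = 0 := hrec 2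
  have r3 : x * φ 3 + y * φ 4 = 0 := hrec 3
  -- If y = 0, only the last entry of φ survives and the second window is the point [0 : 1] of the
  -- cubic. Otherwise the ratio is -x/y and the first window is the point [y : -x].
  by_cases hy0 : y = 0
  · have hx0 : x ≠ 0 := fun hx0 => hxy ⟨hx0, hy0⟩
    simp only [hy0, zero_mul, add_zero, mul_eq_zero, hx0, false_or] at r0 r1 r2 r3
    have hφ4 : φ 4 ≠ 0 := by
      intro r4
      apply hφ
      ext k
      fin_cases k <;> simpa
    refine h.momentVec_ne_real i j (s := 0) (t := 1) (x := (φ 4)⁻¹ * γ) (y := (φ 4)⁻¹ * δ)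
      (by simp) ?_
    ext k
    have e : (φ 4)⁻¹ * φ k.succ = momentVec 3 0 1 k := by
      fin_cases k <;> simp [momentVec, r1, r2, r3, hφ4]
    rw [← e, h2]
    simp only [Pi.add_apply, Pi.smul_apply, smul_eq_mul]
    ring
  · have s1 : φ 1 = -(x / y) * φ 0 := by field_simp; linear_combination r0
    have s2 : φ 2 = -(x / y) * φ 1 := by field_simp; linear_combination r1
    have s3 : φ 3 = -(x / y) * φ 2 := by field_simp; linear_combination r2
    have s4 : φ 4 = -(x / y) * φ 3 := by field_simp; linear_combination r3
    have hφ0 : φ 0 ≠ 0 := by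
      intro hz
      rw [hz, mul_zero] at s1
      rw [s1, mul_zero] at s2
      rw [s2, mul_zero] at s3
      rw [s3, mul_zero] at s4
      apply hφ
      ext k
      fin_cases k <;> simpa
    refine h.momentVec_ne_real i j (s := y) (t := -x) (x := y ^ 3 / φ 0 * α)
      (y := y ^ 3 / φ 0 * β) (Or.inl hy0) ?_
    ext k
    have e : y ^ 3 / φ 0 * φ k.castSucc = momentVec 3 y (-x) k := by
      fin_cases k
      · change y ^ 3 / φ 0 * φ 0 = _
        simp [momentVec]; field_simp
      · change y ^ 3 / φ 0 * φ 1 = _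
        rw [s1]; simp [momentVec]; field_simp
      · change y ^ 3 / φ 0 * φ 2 = _
        rw [s2, s1]; simp [momentVec]; field_simp
      · change y ^ 3 / φ 0 * φ 3 = _
        rw [s3, s2, s1]; simp [momentVec]; field_simp
    rw [← e, h1]
    simp only [Pi.add_apply, Pi.smul_apply, smul_eq_mul]
    ring

/-- The windows of φ form a basis of the line of centers, so each b_i is S(l_i) φ for some linear
form l_i. Thus M_i S(l_i) kills φ and factors through the projection from φ; distinct centers make
the forms independent. -/
theorem exists_quarticModel (h : CollinearCameras M b) :
    ∃ Q B l, QuarticModel M Q B l := by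
  obtain ⟨α, β, γ, δ, h0, φ, h1, h2⟩ := exists_windows (b 0) (b 1)
  have hD := h.windows_det_ne_zero (by decide) h0 h1 h2
  set D := α * δ - β * γ with hDdef
  obtain ⟨s, t, hs, ht, hb⟩ := h.collinear 0 1 2 (by decide) (by decide) (by decide)
  -- The first two forms are the rows of the inverse of the 2×2 matrix of window coefficients; the
  -- third is s·l₀ + t·l₁, since b₂ = s·b₀ + t·b₁.
  let l : Fin 3 → Fin 2 → ℝ := ![![δ / D, -β / D], ![-γ / D, α / D],
    ![(s * δ - t * γ) / D, (t * α - s * β) / D]]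
  have hl0 : ∀ k, δ / D * φ k.castSucc + -β / D * φ k.succ = b 0 k := by
    intro k; rw [h1, h2]; field_simp; rw [hDdef]; ring
  have hl1 : ∀ k, -γ / D * φ k.castSucc + α / D * φ k.succ = b 1 k := by
    intro k; rw [h1, h2]; field_simp; rw [hDdef]; ring
  have hl : ∀ i, shiftMatrix (l i) *ᵥ φ = b i := by
    intro i
    ext k
    rw [shiftMatrix_mulVec_succ]
    fin_cases i
    · exact hl0 k
    · exact hl1 k
    · change (s * δ - t * γ) / D * φ k.castSucc + (t * α - s * β) / D * φ k.succ = b 2 k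
      rw [hb, Pi.add_apply, Pi.smul_apply, Pi.smul_apply, ← hl0, ← hl1, smul_eq_mul, smul_eq_mul]
      ring
  have hφ : φ ≠ 0 := by
    rintro rfl
    exact h.center_ne_zero 0 (by rw [← hl 0, Matrix.mulVec_zero])
  obtain ⟨B, hB, hspan⟩ := exists_rows_orthogonal hφ
  have hQ : ∀ i, ∃ Q : Matrix (Fin 3) (Fin 4) ℝ, Q * B = M i * shiftMatrix (l i) := by
    intro i
    have : ∀ a : Fin 3, ∃ u, (M i * shiftMatrix (l i)) a = u ᵥ* B := by
      intro a
      apply hspan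
      change ((M i * shiftMatrix (l i)) *ᵥ φ) a = 0
      rw [← Matrix.mulVec_mulVec, hl, h.mulVec_center, Pi.zero_apply]
    choose u hu using this
    refine ⟨Matrix.of u, ?_⟩
    ext a c
    rw [hu a]
    rfl
  choose Q hQ using hQ
  refine ⟨Q, B, l, hQ, hB, ?_⟩
  have d01 : l 0 0 * l 1 1 - l 0 1 * l 1 0 ≠ 0 := by
    change δ / D * (α / D) - -β / D * (-γ / D) ≠ 0
    have : δ / D * (α / D) - -β / D * (-γ / D) = 1 / D := by field_simp; rw [hDdef]; ring
    rw [this]; exact one_div_ne_zero hD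
  have d02 : l 0 0 * l 2 1 - l 0 1 * l 2 0 ≠ 0 := by
    change δ / D * ((t * α - s * β) / D) - -β / D * ((s * δ - t * γ) / D) ≠ 0
    have : δ / D * ((t * α - s * β) / D) - -β / D * ((s * δ - t * γ) / D) = t / D := by
      field_simp; rw [hDdef]; ring
    rw [this]; exact div_ne_zero ht hD
  have d12 : l 1 0 * l 2 1 - l 1 1 * l 2 0 ≠ 0 := by
    change -γ / D * ((t * α - s * β) / D) - α / D * ((s * δ - t * γ) / D) ≠ 0
    have : -γ / D * ((t * α - s * β) / D) - α / D * ((s * δ - t * γ) / D) = -s / D := by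
      field_simp; rw [hDdef]; ring
    rw [this]; exact div_ne_zero (neg_ne_zero.mpr hs) hD
  intro i j hij
  have hsymm : ∀ i j, l i 0 * l j 1 - l i 1 * l j 0 ≠ 0 → l j 0 * l i 1 - l j 1 * l i 0 ≠ 0 :=
    fun i j hne hz => hne (by linear_combination -hz)
  fin_cases i <;> fin_cases j <;>
    first
      | exact absurd rfl hij
      | assumption
      | exact hsymm _ _ d01
      | exact hsymm _ _ d02
      | exact hsymm _ _ d12

end CollinearCameras

theorem shiftMatrix_vecMul_injective {l : Fin 2 → ℝ} (hl : l 0 ≠ 0 ∨ l 1 ≠ 0) {v : Fin 4 → ℝ}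
    (hv : v ᵥ* shiftMatrix l = 0) : v = 0 := by
  have e0 := congrFun hv 0
  have e1 := congrFun hv 1
  have e2 := congrFun hv 2
  have e3 := congrFun hv 3
  have e4 := congrFun hv 4
  simp [shiftMatrix, Matrix.vecMul, dotProduct, Fin.sum_univ_four] at e0 e1 e2 e3 e4
  by_cases h0 : l 0 = 0
  · have h1 := hl.resolve_left (not_not.mpr h0)
    simp only [h0, h1, mul_zero, add_zero, or_false] at e1 e2 e3 e4
    ext k
    fin_cases k <;> simp_all
  · simp only [h0, or_false] at e0
    simp only [e0, zero_mul, zero_add, mul_eq_zero, h0, or_false] at e1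
    simp only [e1, zero_mul, zero_add, mul_eq_zero, h0, or_false] at e2
    simp only [e2, zero_mul, zero_add, mul_eq_zero, h0, or_false] at e3
    ext k
    fin_cases k <;> simp_all

namespace QuarticModel

variable {M Q : Fin 3 → Matrix (Fin 3) (Fin 4) ℝ} {B : Matrix (Fin 4) (Fin 5) ℝ}
  {l : Fin 3 → Fin 2 → ℝ} {b : Fin 3 → Fin 4 → ℝ}

theorem coeff_ne_zero (h : QuarticModel M Q B l) (i : Fin 3) : l i 0 ≠ 0 ∨ l i 1 ≠ 0 := by
  obtain ⟨j, hj⟩ := exists_ne i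
  have := h.indep i j hj.symm
  by_contra! hc
  simp [hc.1, hc.2] at this

/-- Multiplication by a nonzero linear form is injective on cubics and M_i has full row rank, so a
row relation of Q_i must vanish. -/
theorem rank_eq (h : QuarticModel M Q B l) (hM : CollinearCameras M b) (i : Fin 3) :
    (Q i).rank = 3 := by
  have hli : LinearIndependent ℝ (Q i).row := by
    rw [← Matrix.vecMul_injective_iff]
    refine (injective_iff_map_eq_zero (Matrix.vecMulLinear (Q i))).mpr ?_
    intro u hu
    have hu' : u ᵥ* Q i = 0 := hu
    have h1 : (u ᵥ* M i) ᵥ* shiftMatrix (l i) = 0 := by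
      rw [Matrix.vecMul_vecMul, ← h.mul_eq, ← Matrix.vecMul_vecMul, hu', Matrix.zero_vecMul]
    have h2 := shiftMatrix_vecMul_injective (h.coeff_ne_zero i) h1
    obtain ⟨G, hG⟩ := hM.right_inv i
    rw [← Matrix.vecMul_one u, ← hG, ← Matrix.vecMul_vecMul, h2, Matrix.zero_vecMul]
  simpa using hli.rank_matrix

/-- The center of Q_i is the quartic point at the root of l_i. Another Q_j does not kill that point,
because l_j has a different root. -/
theorem exists_cameraTuple (h : QuarticModel M Q B l) (hM : CollinearCameras M b) :
    ∃ T : CameraTuple 3, ∀ i, (T.cam i).mat = Q i := by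
  let K : Fin 3 → Camera := fun i => ⟨Q i, h.rank_eq hM i⟩
  refine ⟨⟨K, fun i j hij => ?_⟩, fun i => rfl⟩
  by_contra hne
  have hr := h.root_ne_zero i
  have h1 : (K i).center = _ :=
    (K i).center_eq_mk (h.mulVec_momentVec_ne_zero hM hr) (h.mulVec_root i)
  have h2 : (K j).center = _ := hij.symm.trans h1
  have h3 := (K j).submodule_center
  rw [h2, Projectivization.submodule_mk] at h3
  have h4 : (Q j).toComplex *ᵥ (B.toComplex *ᵥ momentVec 4 (l i 1 : ℂ) (-l i 0 : ℂ)) = 0 := by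
    have := Submodule.mem_span_singleton_self (R := ℂ)
      (B.toComplex *ᵥ momentVec 4 (l i 1 : ℂ) (-l i 0 : ℂ))
    rw [h3] at this
    exact this
  rw [h.mulVec_eq, smul_eq_zero] at h4
  exact h4.elim (h.linForm_root_ne hne) (hM.mulVec_momentVec_ne_zero j hr)

end QuarticModel

/-! ### Fundamental forms and non-triviality of the quartic conjugate -/

/-- (x, α, β) is a kernel vector of the 6×6 matrix. For nonzero u, v it is the epipolar constraint:
x is a common point of the two back-projected rays. -/
theorem fundamentalForm_eq_zero_iff (P P' : Camera) (u v : Fin 3 → ℝ) :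
    fundamentalForm P P' u v = 0 ↔ ∃ (x : Fin 4 → ℝ) (α β : ℝ), (x ≠ 0 ∨ α ≠ 0 ∨ β ≠ 0) ∧
      P.mat *ᵥ x + α • u = 0 ∧ P'.mat *ᵥ x + β • v = 0 := by
  have hmul : ∀ (x : Fin 4 → ℝ) (w : Fin 2 → ℝ),
      Matrix.fromBlocks P.mat (Matrix.of fun k (l : Fin 2) => if l = 0 then u k else 0)
        P'.mat (Matrix.of fun k (l : Fin 2) => if l = 0 then 0 else v k) *ᵥ Sum.elim x w =
      Sum.elim (P.mat *ᵥ x + w 0 • u) (P'.mat *ᵥ x + w 1 • v) := by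
    intro x w
    rw [Matrix.fromBlocks_mulVec]
    congr 1
    · ext k
      simp [Matrix.mulVec, dotProduct, mul_comm]
    · ext k
      simp [Matrix.mulVec, dotProduct, mul_comm]
  rw [fundamentalForm, ← Matrix.exists_mulVec_eq_zero_iff]
  constructor
  · rintro ⟨y, hy0, hy⟩
    rw [Matrix.reindex_apply, Matrix.submatrix_mulVec_equiv, Equiv.symm_symm] at hy
    set y' : Fin 4 ⊕ Fin 2 → ℝ := y ∘ finSumFinEquiv with hy'
    have h1 := hmul (y' ∘ Sum.inl) (y' ∘ Sum.inr)
    rw [Sum.elim_comp_inl_inr] at h1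
    rw [h1] at hy
    refine ⟨y' ∘ Sum.inl, y' (Sum.inr 0), y' (Sum.inr 1), ?_, ?_, ?_⟩
    · by_contra! hc
      apply hy0
      have : y' = 0 := by
        ext k
        rcases k with k | k
        · exact congrFun hc.1 k
        · fin_cases k
          exacts [hc.2.1, hc.2.2]
      ext k
      have := congrFun this (finSumFinEquiv.symm k)
      simpa [hy'] using this
    · ext k
      have := congrFun hy (finSumFinEquiv (Sum.inl k))
      simpa using this
    · ext k
      have := congrFun hy (finSumFinEquiv (Sum.inr k))
      simpa using this
  · rintro ⟨x, α, β, hne, h1, h2⟩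
    refine ⟨Sum.elim x ![α, β] ∘ (finSumFinEquiv (m := 4) (n := 2)).symm, fun h0 => ?_, ?_⟩
    · have h3 : ∀ k, Sum.elim x ![α, β] k = 0 := fun k => by
        simpa using congrFun h0 ((finSumFinEquiv (m := 4) (n := 2)) k)
      have hx : x = 0 := funext fun k => h3 (Sum.inl k)
      have hα : α = 0 := h3 (Sum.inr 0)
      have hβ : β = 0 := h3 (Sum.inr 1)
      simp [hx, hα, hβ] at hne
    · rw [Matrix.reindex_apply, Matrix.submatrix_mulVec_equiv, Function.comp_assoc]
      simp only [Equiv.symm_symm, Equiv.symm_comp_self, Function.comp_id]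
      rw [hmul]
      simp only [Matrix.cons_val_zero, Matrix.cons_val_one, h1, h2]
      ext k
      simp only [Function.comp_apply, Pi.zero_apply]
      rcases finSumFinEquiv.symm k with k | k <;> rfl

theorem fundamentalForm_mulVec_self (P P' : Camera) (x : Fin 4 → ℝ) :
    fundamentalForm P P' (P.mat *ᵥ x) (P'.mat *ᵥ x) = 0 := by
  rw [fundamentalForm_eq_zero_iff]
  exact ⟨x, -1, -1, by norm_num, by module, by module⟩

/-- The fundamental form as the determinant of a matrix with one column replaced. -/
theorem fundamentalForm_eq_updateCol_left (P P' : Camera) (v : Fin 3 → ℝ) :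
    ∃ (W : Matrix (Fin 6) (Fin 6) ℝ) (f : (Fin 3 → ℝ) →ₗ[ℝ] (Fin 6 → ℝ)), ∀ u,
      fundamentalForm P P' u v = (W.updateCol 4 (f u)).det := by
  refine ⟨Matrix.reindex finSumFinEquiv finSumFinEquiv
    (Matrix.fromBlocks P.mat (Matrix.of fun k (l : Fin 2) => 0)
      P'.mat (Matrix.of fun k (l : Fin 2) => if l = 0 then 0 else v k)),
    { toFun := fun u k => Sum.elim u (0 : Fin 3 → ℝ) ((finSumFinEquiv (m := 3) (n := 3)).symm k)
      map_add' := fun u w => by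
        ext k; rcases h : (finSumFinEquiv (m := 3) (n := 3)).symm k with a | a <;> simp [h]
      map_smul' := fun c u => by
        ext k; rcases h : (finSumFinEquiv (m := 3) (n := 3)).symm k with a | a <;> simp [h] }, fun u => ?_⟩
  rw [fundamentalForm]
  congr 1
  ext i j
  have h4 : (4 : Fin 6) = finSumFinEquiv (Sum.inr (0 : Fin 2) : Fin 4 ⊕ Fin 2) := rfl
  obtain ⟨i, rfl⟩ := finSumFinEquiv.surjective i
  obtain ⟨j, rfl⟩ := finSumFinEquiv.surjective j
  rw [Matrix.updateCol_apply, h4]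
  simp only [EmbeddingLike.apply_eq_iff_eq]
  rcases j with j | j
  · rcases i with i | i <;> simp
  · fin_cases j <;> rcases i with i | i <;> simp

theorem fundamentalForm_eq_updateCol_right (P P' : Camera) (u : Fin 3 → ℝ) :
    ∃ (W : Matrix (Fin 6) (Fin 6) ℝ) (f : (Fin 3 → ℝ) →ₗ[ℝ] (Fin 6 → ℝ)), ∀ v,
      fundamentalForm P P' u v = (W.updateCol 5 (f v)).det := by
  refine ⟨Matrix.reindex finSumFinEquiv finSumFinEquiv
    (Matrix.fromBlocks P.mat (Matrix.of fun k (l : Fin 2) => if l = 0 then u k else 0)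
      P'.mat (Matrix.of fun k (l : Fin 2) => 0)),
    { toFun := fun v k => Sum.elim (0 : Fin 3 → ℝ) v ((finSumFinEquiv (m := 3) (n := 3)).symm k)
      map_add' := fun u w => by
        ext k; rcases h : (finSumFinEquiv (m := 3) (n := 3)).symm k with a | a <;> simp [h]
      map_smul' := fun c u => by
        ext k; rcases h : (finSumFinEquiv (m := 3) (n := 3)).symm k with a | a <;> simp [h] }, fun v => ?_⟩
  rw [fundamentalForm]
  congr 1
  ext i j
  have h5 : (5 : Fin 6) = finSumFinEquiv (Sum.inr (1 : Fin 2) : Fin 4 ⊕ Fin 2) := rfl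
  obtain ⟨i, rfl⟩ := finSumFinEquiv.surjective i
  obtain ⟨j, rfl⟩ := finSumFinEquiv.surjective j
  rw [Matrix.updateCol_apply, h5]
  simp only [EmbeddingLike.apply_eq_iff_eq]
  rcases j with j | j
  · rcases i with i | i <;> simp
  · fin_cases j <;> rcases i with i | i <;> simp

section Bilinear

variable (P P' : Camera)

theorem fundamentalForm_add_left (u u' v : Fin 3 → ℝ) :
    fundamentalForm P P' (u + u') v = fundamentalForm P P' u v + fundamentalForm P P' u' v := by
  obtain ⟨W, f, hf⟩ := fundamentalForm_eq_updateCol_left P P' v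
  rw [hf, hf, hf, map_add, Matrix.det_updateCol_add]

theorem fundamentalForm_smul_left (c : ℝ) (u v : Fin 3 → ℝ) :
    fundamentalForm P P' (c • u) v = c * fundamentalForm P P' u v := by
  obtain ⟨W, f, hf⟩ := fundamentalForm_eq_updateCol_left P P' v
  rw [hf, hf, map_smul, Matrix.det_updateCol_smul]

theorem fundamentalForm_add_right (u v v' : Fin 3 → ℝ) :
    fundamentalForm P P' u (v + v') = fundamentalForm P P' u v + fundamentalForm P P' u v' := by
  obtain ⟨W, f, hf⟩ := fundamentalForm_eq_updateCol_right P P' u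
  rw [hf, hf, hf, map_add, Matrix.det_updateCol_add]

theorem fundamentalForm_smul_right (c : ℝ) (u v : Fin 3 → ℝ) :
    fundamentalForm P P' u (c • v) = c * fundamentalForm P P' u v := by
  obtain ⟨W, f, hf⟩ := fundamentalForm_eq_updateCol_right P P' u
  rw [hf, hf, map_smul, Matrix.det_updateCol_smul]

/-- Polarization: a bilinear form vanishing on the diagonal is antisymmetric. -/
theorem fundamentalForm_antisymm {K K' : Matrix (Fin 3) (Fin 4) ℝ}
    (h : ∀ x, fundamentalForm P P' (K *ᵥ x) (K' *ᵥ x) = 0) (x y : Fin 4 → ℝ) :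
    fundamentalForm P P' (K *ᵥ x) (K' *ᵥ y) = -fundamentalForm P P' (K *ᵥ y) (K' *ᵥ x) := by
  have h1 := h (x + y)
  rw [Matrix.mulVec_add, Matrix.mulVec_add, fundamentalForm_add_left, fundamentalForm_add_right,
    fundamentalForm_add_right, h x, h y] at h1
  linear_combination h1

end Bilinear

theorem real_mulVec_shift {l : Fin 2 → ℝ} (s t : ℝ) :
    shiftMatrix l *ᵥ momentVec 4 s t = (l 0 * s + l 1 * t) • momentVec 3 s t := by
  have := shiftMatrix_mulVec_momentVec (R := ℝ) l s t
  simpa [linForm] using this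

namespace CollinearCameras

variable {M : Fin 3 → Matrix (Fin 3) (Fin 4) ℝ} {b : Fin 3 → Fin 4 → ℝ}

/-- Some real point of the cubic spans 3-space together with `[1 : 0 : 0 : 0]` and two centers. -/
theorem exists_momentVec_indep (h : CollinearCameras M b) (i j : Fin 3) :
    ∃ s t : ℝ, t ≠ 0 ∧ ∀ x y z w : ℝ,
      x • momentVec 3 (1 : ℝ) 0 + y • momentVec 3 s t = z • b i + w • b j → x = 0 ∧ y = 0 := by
  let T : Matrix (Fin 3) (Fin 4) ℝ := Matrix.of ![momentVec 3 1 0, b i, b j]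
  have hker : LinearMap.ker T.mulVecLin ≠ ⊥ := LinearMap.ker_ne_bot_of_finrank_lt (by simp)
  obtain ⟨g, hg, hg0⟩ := Submodule.exists_mem_ne_zero_of_ne_bot hker
  have hg' : T *ᵥ g = 0 := hg
  have g0 : momentVec 3 1 0 ⬝ᵥ g = 0 := congrFun hg' 0
  have g1 : b i ⬝ᵥ g = 0 := congrFun hg' 1
  have g2 : b j ⬝ᵥ g = 0 := congrFun hg' 2
  by_contra! hc
  -- If every choice failed, the plane g through [1 : 0 : 0 : 0] and the two centers would contain
  -- the whole real cubic, which spans the space.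
  have key : ∀ s t : ℝ, t ≠ 0 → momentVec 3 s t ⬝ᵥ g = 0 := by
    intro s t ht
    obtain ⟨x, y, z, w, hxy, hne⟩ := hc s t ht
    have hy : y ≠ 0 := by
      rintro rfl
      have hx : x ≠ 0 := fun hx => hne hx rfl
      refine h.momentVec_ne_real i j (s := 1) (t := 0) (x := x⁻¹ * z) (y := x⁻¹ * w)
        (by simp) ?_
      rw [zero_smul, add_zero] at hxy
      rw [← smul_smul, ← smul_smul, ← smul_add, ← hxy, smul_smul, inv_mul_cancel₀ hx, one_smul]
    have := congrArg (· ⬝ᵥ g) hxy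
    simp only [add_dotProduct, smul_dotProduct, g0, g1, g2, smul_zero, zero_add, add_zero,
      smul_eq_zero, hy, false_or] at this
    exact this
  have k1 := key 0 1 one_ne_zero
  have k2 := key 1 1 one_ne_zero
  have k3 := key 1 (-1) (by norm_num)
  simp [momentVec, dotProduct, Fin.sum_univ_four] at g0 k1 k2 k3
  apply hg0
  ext k
  fin_cases k <;> simp <;> linarith

end CollinearCameras

namespace QuarticModel

variable {A A' : Matrix (Fin 4) (Fin 4) ℝ} {P : CameraTuple 3} {Q : Fin 3 → Matrix (Fin 3) (Fin 4) ℝ}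
  {B : Matrix (Fin 4) (Fin 5) ℝ} {l : Fin 3 → Fin 2 → ℝ} {b : Fin 3 → Fin 4 → ℝ}

/-- The epipolar constraints of two cameras are not those of the corresponding cameras of a
quartic model. -/
theorem not_forall_fundamentalForm_eq_zero (h : QuarticModel (fun i => (P.cam i).mat * A) Q B l)
    (hA : A * A' = 1) (hM : CollinearCameras (fun i => (P.cam i).mat * A) b) {i j : Fin 3}
    (hij : i ≠ j) {K K' : Matrix (Fin 3) (Fin 4) ℝ} {c c' : ℝ} (hc : c ≠ 0) (hc' : c' ≠ 0)
    (hK : K * B = c • (Q i * B)) (hK' : K' * B = c' • (Q j * B)) :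
    ¬ ∀ y, fundamentalForm (P.cam i) (P.cam j) (K *ᵥ y) (K' *ᵥ y) = 0 := by
  intro h0
  obtain ⟨s, t, ht, hind⟩ := hM.exists_momentVec_indep i j
  have eval : ∀ (i : Fin 3) (K : Matrix (Fin 3) (Fin 4) ℝ) (c : ℝ), K * B = c • (Q i * B) →
      ∀ s t : ℝ, K *ᵥ (B *ᵥ momentVec 4 s t) =
        (c * (l i 0 * s + l i 1 * t)) • (P.cam i).mat *ᵥ (A *ᵥ momentVec 3 s t) := by
    intro i K c hK s t
    rw [Matrix.mulVec_mulVec, hK, h.mul_eq, Matrix.smul_mulVec, ← Matrix.mulVec_mulVec,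
      real_mulVec_shift, Matrix.mulVec_smul, smul_smul, ← Matrix.mulVec_mulVec]
  have h1 := fundamentalForm_antisymm _ _ h0 (B *ᵥ momentVec 4 1 0) (B *ᵥ momentVec 4 s t)
  have h2 := fundamentalForm_antisymm (P.cam i) (P.cam j)
    (fundamentalForm_mulVec_self (P.cam i) (P.cam j))
    (A *ᵥ momentVec 3 1 0) (A *ᵥ momentVec 3 s t)
  rw [eval i K c hK, eval i K c hK, eval j K' c' hK', eval j K' c' hK', fundamentalForm_smul_left,
    fundamentalForm_smul_right, fundamentalForm_smul_left, fundamentalForm_smul_right] at h1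
  -- Both F(x, y) = -F(y, x) and its version weighted by the values of l_i and l_j hold. Their
  -- difference leaves the determinant of the two forms times t, which is nonzero, so F(x, y) = 0.
  have h3 : c * c' * t * (l i 0 * l j 1 - l i 1 * l j 0) *
      fundamentalForm (P.cam i) (P.cam j) ((P.cam i).mat *ᵥ (A *ᵥ momentVec 3 1 0))
        ((P.cam j).mat *ᵥ (A *ᵥ momentVec 3 s t)) = 0 := by
    linear_combination h1 - c * c' * (l i 0 * s + l i 1 * t) * (l j 0) * h2
  have h4 := (mul_eq_zero.mp h3).resolve_left
    (mul_ne_zero (mul_ne_zero (mul_ne_zero hc hc') ht) (h.indep i j hij))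
  -- The rays through the two chosen points would then meet, which is a linear relation among those
  -- points and the two centers.
  rw [fundamentalForm_eq_zero_iff] at h4
  obtain ⟨x, α, β, hne, e1, e2⟩ := h4
  have hx : x = A *ᵥ (A' *ᵥ x) := by rw [Matrix.mulVec_mulVec, hA, Matrix.one_mulVec]
  obtain ⟨z, hz⟩ := hM.ker_real i (v := A' *ᵥ x + α • momentVec 3 1 0) (by
    rw [← Matrix.mulVec_mulVec, Matrix.mulVec_add, ← hx, Matrix.mulVec_smul, Matrix.mulVec_add,
      Matrix.mulVec_smul, e1])
  obtain ⟨w, hw⟩ := hM.ker_real j (v := A' *ᵥ x + β • momentVec 3 s t) (by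
    rw [← Matrix.mulVec_mulVec, Matrix.mulVec_add, ← hx, Matrix.mulVec_smul, Matrix.mulVec_add,
      Matrix.mulVec_smul, e2])
  have h5 := hind α (-β) z (-w) (by rw [neg_smul, neg_smul, ← hz, ← hw]; abel)
  have hβ : β = 0 := neg_eq_zero.mp h5.2
  rw [h5.1, zero_smul, add_zero] at hz
  rw [hβ, zero_smul, add_zero] at hw
  have h6 := hM.indep i j hij z (-w) (by rw [← hz, neg_smul, ← hw, add_neg_cancel])
  rw [h6.1, zero_smul] at hz
  rw [hz, Matrix.mulVec_zero] at hx
  simp [hx, h5.1, hβ] at hne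

theorem not_sameFundamental {T : CameraTuple 3}
    (h : QuarticModel (fun i => (P.cam i).mat * A) (fun i => (T.cam i).mat) B l)
    (hA : A * A' = 1) (hM : CollinearCameras (fun i => (P.cam i).mat * A) b) {i j : Fin 3}
    (hij : i ≠ j) : ¬ SameFundamental (P.cam i) (P.cam j) (T.cam i) (T.cam j) := by
  rintro ⟨c, -, hF⟩
  refine h.not_forall_fundamentalForm_eq_zero hA hM hij (K := (T.cam i).mat) (K' := (T.cam j).mat)
    one_ne_zero one_ne_zero (one_smul _ _).symm (one_smul _ _).symm fun y => ?_
  rw [hF, fundamentalForm_mulVec_self, mul_zero]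

/-- An equivalence H would make P_iH⁻¹ proportional to T_i, so the epipolar constraints of P would
hold for T; this is the same obstruction as for fundamental matrices. -/
theorem not_camerasEquivVia {T : CameraTuple 3}
    (h : QuarticModel (fun i => (P.cam i).mat * A) (fun i => (T.cam i).mat) B l)
    (hA : A * A' = 1) (hM : CollinearCameras (fun i => (P.cam i).mat * A) b)
    (H : GL (Fin 4) ℝ) : ¬ CamerasEquivVia H P T := by
  intro hH
  obtain ⟨c, hc, e⟩ := hH 0
  obtain ⟨c', hc', e'⟩ := hH 1
  refine h.not_forall_fundamentalForm_eq_zero hA hM (i := 0) (j := 1) (by decide)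
    (K := (P.cam 0).mat * (H⁻¹).val) (K' := (P.cam 1).mat * (H⁻¹).val) hc hc'
    (by rw [e, Matrix.smul_mul]) (by rw [e', Matrix.smul_mul]) fun y => ?_
  rw [← Matrix.mulVec_mulVec, ← Matrix.mulVec_mulVec, fundamentalForm_mulVec_self]

/-- The points of a quartic model over a set of points of the cubic. -/
def pointsOver (A : Matrix (Fin 4) (Fin 4) ℝ) (B : Matrix (Fin 4) (Fin 5) ℝ) (X : Set Space) :
    Set Space :=
  {y | ∃ (s t : ℂ) (hA : A.toComplex *ᵥ momentVec 3 s t ≠ 0)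
    (hB : B.toComplex *ᵥ momentVec 4 s t ≠ 0), (s ≠ 0 ∨ t ≠ 0) ∧
      Projectivization.mk ℂ _ hA ∈ X ∧ y = Projectivization.mk ℂ _ hB}

/-- The common set of image tuples is everything P sees of X. No point of the cubic is a center of
P, so its images are determined, and the quartic point with the same parameter accounts for them,
even where some l_i vanishes. -/
theorem isNontrivialConjugate {T : CameraTuple 3}
    (h : QuarticModel (fun i => (P.cam i).mat * A) (fun i => (T.cam i).mat) B l)
    (hA : A * A' = 1) (hM : CollinearCameras (fun i => (P.cam i).mat * A) b)
    {X : Set Space} (hX : X ⊆ {x | ∃ (s t : ℂ) (h : A.toComplex *ᵥ momentVec 3 s t ≠ 0),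
        (s ≠ 0 ∨ t ≠ 0) ∧ x = Projectivization.mk ℂ _ h}) :
    IsNontrivialConjugate P X T (pointsOver A B X) := by
  refine ⟨⟨⟨{z | ∃ x ∈ X, P.Sees x z}, ⟨fun z hz => hz, fun x hx => ?_⟩, fun z hz => ?_,
    fun y hy => ?_⟩, ?_⟩, fun i j hij => h.not_sameFundamental hA hM hij⟩
  · obtain ⟨s, t, h0, hst, rfl⟩ := hX hx
    have hne : ∀ i, (P.cam i).mat.toComplex *ᵥ (A.toComplex *ᵥ momentVec 3 s t) ≠ 0 := fun i => by
      rw [Matrix.toComplex_mulVec_mulVec]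
      exact hM.mulVec_momentVec_ne_zero i hst
    refine ⟨fun i => Projectivization.mk ℂ _ (hne i), ⟨_, hx, ?_⟩, ?_⟩ <;>
    · rw [CameraTuple.sees_mk]
      intro i
      obtain ⟨a, ha⟩ := Projectivization.exists_smul_eq_mk_rep ℂ _ (hne i)
      refine ⟨(a : ℂ)⁻¹, ?_⟩
      rw [← ha, Units.smul_def, smul_smul, inv_mul_cancel₀ a.ne_zero, one_smul]
  · obtain ⟨x, hx, hs⟩ := hz
    obtain ⟨s, t, h0, hst, rfl⟩ := hX hx
    have hB := h.mulVec_momentVec_ne_zero hM hst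
    refine ⟨Projectivization.mk ℂ _ hB, ⟨s, t, h0, hB, hst, hx, rfl⟩, ?_⟩
    rw [CameraTuple.sees_mk] at hs ⊢
    intro i
    obtain ⟨c, hc⟩ := hs i
    refine ⟨linForm (l i) s t * c, ?_⟩
    rw [h.mulVec_eq, ← smul_smul, ← hc, Matrix.toComplex_mulVec_mulVec]
  · obtain ⟨s, t, h0, hB, hst, hx, rfl⟩ := hy
    have hne : ∀ i, (P.cam i).mat.toComplex *ᵥ (A.toComplex *ᵥ momentVec 3 s t) ≠ 0 := fun i => by
      rw [Matrix.toComplex_mulVec_mulVec]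
      exact hM.mulVec_momentVec_ne_zero i hst
    refine ⟨fun i => Projectivization.mk ℂ _ (hne i), ⟨_, hx, ?_⟩, ?_⟩
    · rw [CameraTuple.sees_mk]
      intro i
      obtain ⟨a, ha⟩ := Projectivization.exists_smul_eq_mk_rep ℂ _ (hne i)
      refine ⟨(a : ℂ)⁻¹, ?_⟩
      rw [← ha, Units.smul_def, smul_smul, inv_mul_cancel₀ a.ne_zero, one_smul]
    · rw [CameraTuple.sees_mk]
      intro i
      obtain ⟨a, ha⟩ := Projectivization.exists_smul_eq_mk_rep ℂ _ (hne i)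
      refine ⟨linForm (l i) s t * (a : ℂ)⁻¹, ?_⟩
      rw [h.mulVec_eq, ← ha, Units.smul_def, smul_smul, mul_assoc, inv_mul_cancel₀ a.ne_zero,
        mul_one, Matrix.toComplex_mulVec_mulVec]
  · rintro ⟨H, -, hH⟩
    exact h.not_camerasEquivVia hA hM H hH

end QuarticModel

/-! ### Polynomial triangulation along the cubic -/

open Polynomial in
/-- A real matrix regarded as a matrix of constant polynomials. -/
noncomputable abbrev Matrix.toPoly {m n : Type*} (A : Matrix m n ℝ) : Matrix m n ℝ[X] :=
  A.map (algebraMap ℝ ℝ[X])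

section Polynomials

open Polynomial

theorem Matrix.toPoly_mul {l m n : Type*} [Fintype m] (A : Matrix l m ℝ) (B : Matrix m n ℝ) :
    (A * B).toPoly = A.toPoly * B.toPoly :=
  Matrix.map_mul

theorem Matrix.toPoly_mulVec_mulVec {l m n : Type*} [Fintype m] [Fintype n]
    (A : Matrix l m ℝ) (B : Matrix m n ℝ) (v : n → ℝ[X]) :
    A.toPoly *ᵥ (B.toPoly *ᵥ v) = (A * B).toPoly *ᵥ v := by
  rw [Matrix.toPoly_mul, Matrix.mulVec_mulVec]

theorem toPoly_mulVec_momentVec_coeff {m : Type*} {d : ℕ} (A : Matrix m (Fin (d + 1)) ℝ)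
    (a : m) (k : Fin (d + 1)) :
    ((A.toPoly *ᵥ momentVec d 1 X) a).coeff k = A a k := by
  simp only [Matrix.mulVec, dotProduct, momentVec, Matrix.map_apply, one_pow, one_mul,
    algebraMap_eq, finsetSum_coeff, coeff_C_mul_X_pow]
  rw [Finset.sum_eq_single k]
  · simp
  · intro j _ hj
    rw [if_neg (fun h => hj (Fin.ext h.symm))]
  · simp

theorem toPoly_mulVec_momentVec_injective {m : Type*} {d : ℕ}
    {A B : Matrix m (Fin (d + 1)) ℝ}
    (h : A.toPoly *ᵥ momentVec d 1 X = B.toPoly *ᵥ momentVec d 1 X) : A = B := by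
  ext a k
  rw [← toPoly_mulVec_momentVec_coeff A, h, toPoly_mulVec_momentVec_coeff]

theorem smul_toPoly_mulVec {m n : Type*} [Fintype n] (c : ℝ) (A : Matrix m n ℝ) (v : n → ℝ[X]) :
    (c • A).toPoly *ᵥ v = C c • (A.toPoly *ᵥ v) := by
  rw [← Matrix.smul_mulVec]
  congr 1
  ext
  simp

/-- The system of equations `Qᵢ y = cᵢ Mᵢ (1, x, x², x³)` in the unknowns `y` and `c`. -/
noncomputable def triangulationMatrix {R : Type*} [CommRing R] [Algebra ℝ R]
    (M Q : Fin 3 → Matrix (Fin 3) (Fin 4) ℝ) (x : R) :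
    Matrix (Fin 3 × Fin 3) (Fin 4 ⊕ Fin 3) R :=
  Matrix.of fun p => Sum.elim (fun k => algebraMap ℝ R (Q p.1 p.2 k))
    (fun k => if k = p.1 then -(((M p.1).map (algebraMap ℝ R) *ᵥ momentVec 3 1 x) p.2) else 0)

theorem triangulationMatrix_mulVec {R : Type*} [CommRing R] [Algebra ℝ R]
    (M Q : Fin 3 → Matrix (Fin 3) (Fin 4) ℝ) (x : R) (y : Fin 4 → R) (c : Fin 3 → R)
    (p : Fin 3 × Fin 3) : (triangulationMatrix M Q x *ᵥ Sum.elim y c) p =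
      ((Q p.1).map (algebraMap ℝ R) *ᵥ y) p.2 -
        c p.1 * ((M p.1).map (algebraMap ℝ R) *ᵥ momentVec 3 1 x) p.2 := by
  simp only [triangulationMatrix, Matrix.mulVec, dotProduct, Fintype.sum_sum_type, Matrix.of_apply,
    Sum.elim_inl, Sum.elim_inr, Matrix.map_apply, ite_mul, zero_mul, Finset.sum_ite_eq',
    Finset.mem_univ, if_true]
  ring

theorem triangulationMatrix_map (M Q : Fin 3 → Matrix (Fin 3) (Fin 4) ℝ) (τ : ℝ) :
    (triangulationMatrix M Q (X : ℝ[X])).map (evalRingHom τ) = triangulationMatrix M Q τ := by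
  ext p k
  rcases k with k | k
  · simp [triangulationMatrix]
  · simp only [triangulationMatrix, Matrix.map_apply, Matrix.of_apply, Sum.elim_inr, apply_ite,
      map_neg, map_zero]
    split_ifs
    · simp [Matrix.mulVec, dotProduct, momentVec]
    · rfl

/-- If the triangulation problem can be solved at every real point of the cubic, then it has a
polynomial solution. -/
theorem exists_polynomial_solution (M Q : Fin 3 → Matrix (Fin 3) (Fin 4) ℝ)
    (h : ∀ τ : ℝ, ∃ (y : Fin 4 → ℂ) (c : Fin 3 → ℂ), y ≠ 0 ∧ ∀ i,
      (Q i).toComplex *ᵥ y = c i • (M i).toComplex *ᵥ momentVec 3 1 (τ : ℂ)) :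
    ∃ (Y : Fin 4 → ℝ[X]) (c : Fin 3 → ℝ[X]), (Y ≠ 0 ∨ c ≠ 0) ∧ ∀ i,
      (Q i).toPoly *ᵥ Y = c i • (M i).toPoly *ᵥ momentVec 3 1 X := by
  set T := triangulationMatrix M Q (X : ℝ[X]) with hT
  have hreal : ∀ τ : ℝ, ∃ v ≠ 0, triangulationMatrix M Q τ *ᵥ v = 0 := by
    intro τ
    obtain ⟨y, c, hy, hyc⟩ := h τ
    have hzero : triangulationMatrix M Q (τ : ℂ) *ᵥ Sum.elim y c = 0 := by
      ext p
      rw [triangulationMatrix_mulVec, hyc]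
      exact sub_self _
    have hmap : triangulationMatrix M Q (τ : ℂ) = (triangulationMatrix M Q τ).toComplex := by
      ext p k
      rcases k with k | k
      · simp [triangulationMatrix]
      · simp only [triangulationMatrix, Matrix.map_apply, Matrix.of_apply, Sum.elim_inr, apply_ite,
          map_neg, map_zero]
        split_ifs
        · simp [Matrix.mulVec, dotProduct, momentVec]
        · rfl
    rw [hmap] at hzero
    -- At a real parameter the system is real, so real and imaginary parts are solutions, and one of
    -- them is nonzero.
    have hre : triangulationMatrix M Q τ *ᵥ (fun k => (Sum.elim y c k).re) = 0 := by
      ext p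
      simpa [Matrix.mulVec, dotProduct] using congrArg Complex.re (congrFun hzero p)
    have him : triangulationMatrix M Q τ *ᵥ (fun k => (Sum.elim y c k).im) = 0 := by
      ext p
      simpa [Matrix.mulVec, dotProduct] using congrArg Complex.im (congrFun hzero p)
    by_cases h0 : (fun k => (Sum.elim y c k).re) = 0
    · refine ⟨_, fun h1 => hy ?_, him⟩
      ext k
      exact Complex.ext (congrFun h0 (Sum.inl k)) (congrFun h1 (Sum.inl k))
    · exact ⟨_, h0, hre⟩
  -- The system is not square; its Gram determinant is a polynomial vanishing at every real
  -- parameter, hence zero.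
  have hdet : (Tᵀ * T).det = 0 := by
    refine Polynomial.funext fun τ => ?_
    rw [eval_zero, ← coe_evalRingHom, RingHom.map_det, RingHom.mapMatrix_apply, Matrix.map_mul,
      Matrix.transpose_map, hT, triangulationMatrix_map]
    obtain ⟨v, hv0, hv⟩ := hreal τ
    refine Matrix.exists_mulVec_eq_zero_iff.mp ⟨v, hv0, ?_⟩
    rw [← Matrix.mulVec_mulVec, hv, Matrix.mulVec_zero]
  obtain ⟨v, hv0, hv⟩ := Matrix.exists_mulVec_eq_zero_iff.mpr hdet
  have hTv : T *ᵥ v = 0 := by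
    -- A sum of squares of real polynomials is zero only if each is, so a kernel vector of TᵀT is
    -- one of T.
    have h1 : (T *ᵥ v) ⬝ᵥ (T *ᵥ v) = 0 := by
      rw [Matrix.dotProduct_mulVec, Matrix.vecMul_mulVec, ← Matrix.dotProduct_mulVec,
        hv, dotProduct_zero]
    ext1 p
    refine Polynomial.funext fun τ => ?_
    have h2 : (fun p => eval τ ((T *ᵥ v) p)) ⬝ᵥ (fun p => eval τ ((T *ᵥ v) p)) = 0 := by
      have := congrArg (eval τ) h1
      simpa [dotProduct, eval_finsetSum] using this
    simpa using congrFun (dotProduct_self_eq_zero.mp h2) p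
  refine ⟨v ∘ Sum.inl, v ∘ Sum.inr, ?_, fun i => ?_⟩
  · by_contra! hc
    apply hv0
    rw [← Sum.elim_comp_inl_inr v, hc.1, hc.2]
    ext k; rcases k with k | k <;> simp
  · ext1 a
    have := congrFun hTv (i, a)
    rw [← Sum.elim_comp_inl_inr v, triangulationMatrix_mulVec, Pi.zero_apply, sub_eq_zero] at this
    exact this

/-- The binary cubic with given coefficients, dehomogenized. -/
noncomputable def cubicPoly : (Fin 4 → ℝ) →ₗ[ℝ] ℝ[X] where
  toFun v := C (v 0) + C (v 1) * X + C (v 2) * X ^ 2 + C (v 3) * X ^ 3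
  map_add' v w := by simp only [Pi.add_apply, C_add]; ring
  map_smul' c v := by
    simp only [Pi.smul_apply, smul_eq_mul, C_mul, RingHom.id_apply, smul_eq_C_mul]; ring

theorem cubicPoly_apply (v : Fin 4 → ℝ) :
    cubicPoly v = C (v 0) + C (v 1) * X + C (v 2) * X ^ 2 + C (v 3) * X ^ 3 := rfl

theorem natDegree_cubicPoly (v : Fin 4 → ℝ) : (cubicPoly v).natDegree ≤ 3 := by
  rw [cubicPoly_apply]
  compute_degree

theorem cubicPoly_coeff (v : Fin 4 → ℝ) (k : Fin 4) : (cubicPoly v).coeff k = v k := by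
  rw [cubicPoly_apply]
  fin_cases k <;> simp [coeff_X, coeff_C, coeff_X_pow]

theorem cubicPoly_injective : Function.Injective cubicPoly := by
  intro v w h
  ext k
  rw [← cubicPoly_coeff v, h, cubicPoly_coeff]

theorem aeval_cubicPoly (v : Fin 4 → ℝ) (z : ℂ) :
    aeval z (cubicPoly v) = complexVec v ⬝ᵥ momentVec 3 1 z := by
  simp [cubicPoly_apply, dotProduct, Fin.sum_univ_four, momentVec]

theorem cubicPoly_vecMul (u : Fin 3 → ℝ) (M : Matrix (Fin 3) (Fin 4) ℝ) :
    cubicPoly (u ᵥ* M) = (fun a => C (u a)) ⬝ᵥ (M.toPoly *ᵥ momentVec 3 1 X) := by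
  simp [cubicPoly_apply, Matrix.vecMul, Matrix.mulVec, dotProduct, Fin.sum_univ_four,
    Fin.sum_univ_three, momentVec]
  ring

end Polynomials

/-! ### The pencil of planes through the line of centers, restricted to the cubic -/

section PolynomialPencils

open Polynomial

theorem exists_dual_basis {b₁ b₂ : Fin 4 → ℝ}
    (h : ∀ x y : ℝ, x • b₁ + y • b₂ = 0 → x = 0 ∧ y = 0) :
    ∃ E G : Matrix (Fin 4) (Fin 4) ℝ, E * G = 1 ∧ G * E = 1 ∧
      (∀ k, E k 0 = b₁ k) ∧ ∀ k, E k 1 = b₂ k := by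
  have h2 : LinearIndependent ℝ ![b₁, b₂] := LinearIndependent.pair_iff.mpr h
  obtain ⟨f₁, h3⟩ := exists_linearIndependent_snoc_of_lt_finrank h2 (by simp)
  obtain ⟨f₂, h4⟩ := exists_linearIndependent_snoc_of_lt_finrank h3 (by simp)
  let F : Matrix (Fin 4) (Fin 4) ℝ := Matrix.of (Fin.snoc (Fin.snoc ![b₁, b₂] f₁) f₂)
  obtain ⟨u, hu⟩ : IsUnit F := Matrix.linearIndependent_rows_iff_isUnit.mp h4
  refine ⟨Fᵀ, (↑u⁻¹ : Matrix (Fin 4) (Fin 4) ℝ)ᵀ, ?_, ?_, fun k => rfl, fun k => rfl⟩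
  · rw [← Matrix.transpose_mul, ← hu, u.inv_mul, Matrix.transpose_one]
  · rw [← Matrix.transpose_mul, ← hu, u.mul_inv, Matrix.transpose_one]

/-- `IsCoprime` excludes common zeros at finite parameters; the condition on the cubic coefficients
excludes the one at infinity and is what bounds the degree of the quotient. -/
theorem exists_quotient_of_isCoprime {a b f g : ℝ[X]} (hab : IsCoprime a b)
    (ha : a.natDegree ≤ 3) (hb : b.natDegree ≤ 3) (h3 : a.coeff 3 ≠ 0 ∨ b.coeff 3 ≠ 0) {d : ℕ}
    (hf : f.natDegree ≤ 3 + d) (hg : g.natDegree ≤ 3 + d) (h : a * f = b * g) :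
    ∃ q : ℝ[X], q.natDegree ≤ d ∧ f = b * q ∧ g = a * q := by
  have key : ∀ p q : ℝ[X], p.natDegree ≤ 3 → p.coeff 3 ≠ 0 → (p * q).natDegree ≤ 3 + d →
      q.natDegree ≤ d := by
    intro p q hp hp3 hpq
    have hp' : p.natDegree = 3 := le_antisymm hp (le_natDegree_of_ne_zero hp3)
    by_cases hq : q = 0
    · simp [hq]
    · rw [natDegree_mul (by rintro rfl; simp at hp3) hq, hp'] at hpq
      omega
  by_cases ha0 : a = 0
  · have hb3 := h3.resolve_left (by simp [ha0])
    have hbu : IsUnit b := by rwa [ha0, isCoprime_zero_left] at hab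
    rw [ha0, zero_mul, eq_comm, mul_eq_zero, or_iff_right hbu.ne_zero] at h
    obtain ⟨q, rfl⟩ : b ∣ f := hbu.dvd
    exact ⟨q, key b q hb hb3 hf, rfl, by rw [h, ha0, zero_mul]⟩
  · obtain ⟨q, rfl⟩ : a ∣ g := hab.dvd_of_dvd_mul_left ⟨f, h.symm⟩
    have hfq : f = b * q := mul_left_cancel₀ ha0 (by linear_combination h)
    refine ⟨q, ?_, hfq, rfl⟩
    rcases h3 with h3 | h3
    · exact key a q ha h3 hg
    · exact key b q hb h3 (hfq ▸ hf)

namespace CollinearCameras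

variable {M : Fin 3 → Matrix (Fin 3) (Fin 4) ℝ} {b : Fin 3 → Fin 4 → ℝ}

/-- The cubics vanishing on the line of centers, restricted to the twisted cubic, have no
common zeros. -/
theorem coprimePencil (h : CollinearCameras M b) {i j : Fin 3} {E G : Matrix (Fin 4) (Fin 4) ℝ}
    (hEG : E * G = 1) (h0 : ∀ k, E k 0 = b i k) (h1 : ∀ k, E k 1 = b j k) :
    CoprimePencil (Submodule.span ℝ {cubicPoly (G 2), cubicPoly (G 3)}) := by
  -- A common zero is a point of the cubic with only b_i, b_j components in the basis E, that is, on
  -- the line of centers.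
  have hpt : ∀ s t : ℂ, (s ≠ 0 ∨ t ≠ 0) → ¬ (complexVec (G 2) ⬝ᵥ momentVec 3 s t = 0 ∧
      complexVec (G 3) ⬝ᵥ momentVec 3 s t = 0) := by
    rintro s t hst ⟨e2, e3⟩
    refine h.disjoint i j s t hst (complexVec (G 0) ⬝ᵥ momentVec 3 s t)
      (complexVec (G 1) ⬝ᵥ momentVec 3 s t) ?_
    have hv : momentVec 3 s t = E.toComplex *ᵥ (G.toComplex *ᵥ momentVec 3 s t) := by
      rw [Matrix.toComplex_mulVec_mulVec, hEG]
      simp [Matrix.toComplex]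
    have hG : ∀ r, (G.toComplex *ᵥ momentVec 3 s t) r = complexVec (G r) ⬝ᵥ momentVec 3 s t :=
      fun r => rfl
    ext k
    refine (congrFun hv k).trans ?_
    rw [Matrix.mulVec, dotProduct, Fin.sum_univ_four, hG, hG, hG, hG, e2, e3]
    simp [h0, h1]
    ring
  intro a ha c hc hind d f g hf hg hfg
  obtain ⟨x, y, rfl⟩ := Submodule.mem_span_pair.mp ha
  obtain ⟨x', y', rfl⟩ := Submodule.mem_span_pair.mp hc
  iterate 2 rw [← map_smul, ← map_smul, ← map_add] at hfg hind ⊢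
  have hD : x * y' - x' * y ≠ 0 := by
    intro hD
    have key : ∀ p q : ℝ, p * x + q * x' = 0 → p * y + q * y' = 0 → p = 0 ∧ q = 0 := by
      intro p q e1 e2
      refine hind p q ?_
      rw [← smul_eq_C_mul, ← smul_eq_C_mul, ← map_smul, ← map_smul, ← map_add]
      convert map_zero cubicPoly
      rw [smul_add, smul_add, smul_smul, smul_smul, smul_smul, smul_smul]
      calc _ = (p * x + q * x') • G 2 + (p * y + q * y') • G 3 := by module
        _ = 0 := by rw [e1, e2]; module
    have k1 := key x' (-x) (by ring) (by linear_combination -hD)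
    have k2 := key y' (-y) (by linear_combination hD) (by ring)
    have k3 := key 1 1 (by simp [neg_eq_zero.mp k1.2, k1.1]) (by simp [neg_eq_zero.mp k2.2, k2.1])
    exact one_ne_zero k3.1
  have hcommon : ∀ s t : ℂ, (s ≠ 0 ∨ t ≠ 0) →
      ¬ (complexVec (x • G 2 + y • G 3) ⬝ᵥ momentVec 3 s t = 0 ∧
        complexVec (x' • G 2 + y' • G 3) ⬝ᵥ momentVec 3 s t = 0) := by
    rintro s t hst ⟨e1, e2⟩
    rw [complexVec_add, complexVec_smul, complexVec_smul, add_dotProduct, smul_dotProduct,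
      smul_dotProduct, smul_eq_mul, smul_eq_mul] at e1 e2
    have hD' : (x * y' - x' * y : ℂ) ≠ 0 := by exact_mod_cast hD
    refine hpt s t hst ⟨(mul_eq_zero.mp ?_).resolve_left hD', (mul_eq_zero.mp ?_).resolve_left hD'⟩
    · linear_combination (y' : ℂ) * e1 - (y : ℂ) * e2
    · linear_combination (x : ℂ) * e2 - (x' : ℂ) * e1
  refine exists_quotient_of_isCoprime ?_ (natDegree_cubicPoly _) (natDegree_cubicPoly _) ?_ hf hg hfg
  · rw [isCoprime_iff_aeval_ne_zero_of_isAlgClosed ℝ ℂ]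
    intro z
    rw [aeval_cubicPoly, aeval_cubicPoly]
    by_contra! hc
    exact hcommon 1 z (by simp) hc
  -- Both cubic coefficients vanishing is a common zero at the parameter [0 : 1].
  · by_contra! hc
    refine hcommon 0 1 (by simp) ?_
    have e1 := (cubicPoly_coeff (x • G 2 + y • G 3) 3).symm.trans hc.1
    have e2 := (cubicPoly_coeff (x' • G 2 + y' • G 3) 3).symm.trans hc.2
    have hlast : ∀ v : Fin 4 → ℝ, complexVec v ⬝ᵥ momentVec 3 0 1 = (v 3 : ℂ) := by
      intro v
      simp [dotProduct, Fin.sum_univ_four, momentVec]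
    rw [hlast, hlast, e1, e2]
    simp

/-- Complete b_i, b_j to a basis with dual basis G. The planes G₂, G₃ contain all three centers and
span N. Further planes through b_i, b_j and b_k = s·b_i + t·b_j are G₁, G₀ and sG₁ - tG₀, which
explains the shape of the third net. -/
theorem exists_pencilTriple (h : CollinearCameras M b) {i j k : Fin 3} (hij : i ≠ j) (hik : i ≠ k)
    (hjk : j ≠ k) {c : Fin 3 → ℝ[X]} (hc : c k ≠ 0)
    (hind : ∀ x y : ℝ, C x * c i + C y * c j = 0 → x = 0 ∧ y = 0) {V : Submodule ℝ ℝ[X]}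
    (hfin : FiniteDimensional ℝ V) (hV : Module.finrank ℝ V ≤ 4)
    (hmem : ∀ i v, v ⬝ᵥ b i = 0 → c i * cubicPoly v ∈ V) :
    ∃ N k₁ k₂ s t, PencilTriple N V k₁ k₂ (c i) (c j) (c k) s t := by
  obtain ⟨E, G, hEG, hGE, h0, h1⟩ := exists_dual_basis (h.indep i j hij)
  obtain ⟨s, t, hs, ht, hk⟩ := h.collinear i j k hij hik hjk
  have hGi : ∀ r, G r ⬝ᵥ b i = (1 : Matrix (Fin 4) (Fin 4) ℝ) r 0 := by
    intro r
    rw [← hGE, Matrix.mul_apply]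
    simp [dotProduct, h0]
  have hGj : ∀ r, G r ⬝ᵥ b j = (1 : Matrix (Fin 4) (Fin 4) ℝ) r 1 := by
    intro r
    rw [← hGE, Matrix.mul_apply]
    simp [dotProduct, h1]
  have hrows : ∀ g : Fin 4 → ℝ,
      cubicPoly (g 0 • G 0 + g 1 • G 1 + g 2 • G 2 + g 3 • G 3) = 0 → g = 0 := by
    intro g hg
    have hg' : g ᵥ* G = 0 := by
      rw [Matrix.vecMul_eq_sum, Fin.sum_univ_four]
      exact cubicPoly_injective (hg.trans (map_zero _).symm)
    rw [← Matrix.vecMul_one g, ← hGE, ← Matrix.vecMul_vecMul, hg', Matrix.zero_vecMul]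
  have hperp : ∀ v, v ⬝ᵥ b i = 0 → v ⬝ᵥ b j = 0 → v ⬝ᵥ b k = 0 := by
    intro v e1 e2
    rw [hk, dotProduct_add, dotProduct_smul, dotProduct_smul, e1, e2, smul_zero, smul_zero,
      add_zero]
  have hN : ∀ a ∈ Submodule.span ℝ {cubicPoly (G 2), cubicPoly (G 3)},
      ∃ v, a = cubicPoly v ∧ v ⬝ᵥ b i = 0 ∧ v ⬝ᵥ b j = 0 := by
    intro a ha
    obtain ⟨x, y, rfl⟩ := Submodule.mem_span_pair.mp ha
    refine ⟨x • G 2 + y • G 3, by simp, ?_, ?_⟩ <;> simp [hGi, hGj]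
  refine ⟨Submodule.span ℝ {cubicPoly (G 2), cubicPoly (G 3)}, cubicPoly (G 1), cubicPoly (G 0),
    s, t, ?_, h.coprimePencil hEG h0 h1, ?_, natDegree_cubicPoly _, natDegree_cubicPoly _, ?_,
    hfin, hV, hs, ht, hc, hind, ?_, ?_, ?_, ?_, ?_, ?_⟩
  · have hli : LinearIndependent ℝ ![cubicPoly (G 2), cubicPoly (G 3)] := by
      rw [LinearIndependent.pair_iff]
      intro x y hxy
      have := hrows ![0, 0, x, y] (by simpa using hxy)
      exact ⟨congrFun this 2, congrFun this 3⟩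
    have := finrank_span_eq_card hli
    rw [Matrix.range_cons, Matrix.range_cons, Matrix.range_empty, Set.union_empty,
      Set.singleton_union] at this
    simpa using this
  · intro a ha
    obtain ⟨v, rfl, -⟩ := hN a ha
    exact natDegree_cubicPoly v
  · intro x y hxy
    obtain ⟨z, w, hzw⟩ := Submodule.mem_span_pair.mp hxy
    have := hrows ![y, x, -z, -w] (by
      rw [← smul_eq_C_mul, ← smul_eq_C_mul] at hzw
      simp only [map_add, map_smul, Matrix.cons_val]
      rw [neg_smul, neg_smul, add_assoc, ← neg_add, hzw]
      abel)
    exact ⟨congrFun this 1, congrFun this 0⟩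
  · intro a ha
    obtain ⟨v, rfl, e1, e2⟩ := hN a ha
    exact hmem i v e1
  · intro a ha
    obtain ⟨v, rfl, e1, e2⟩ := hN a ha
    exact hmem j v e2
  · intro a ha
    obtain ⟨v, rfl, e1, e2⟩ := hN a ha
    exact hmem k v (hperp v e1 e2)
  · exact hmem i _ (by simp [hGi])
  · exact hmem j _ (by simp [hGj])
  · have := hmem k (s • G 1 - t • G 0) (by
      rw [hk]
      simp [hGi, hGj]
      ring)
    simpa [smul_eq_C_mul] using this

end CollinearCameras

end PolynomialPencils

/-! ### Polynomial solutions yield a quartic model or a projective transformation -/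

theorem CameraTuple.eq_zero_of_mulVec {n : ℕ} (T : CameraTuple n) {i j : Fin n} (hij : i ≠ j)
    {v : Fin 4 → ℝ} (hi : (T.cam i).mat *ᵥ v = 0) (hj : (T.cam j).mat *ᵥ v = 0) : v = 0 := by
  by_contra hv
  have hv' : complexVec v ≠ 0 := fun h => hv (complexVec_eq_zero.mp h)
  apply hij
  apply T.distinct_centers
  change (T.cam i).center = (T.cam j).center
  rw [(T.cam i).center_eq_mk hv' (by rw [complexVec_mulVec, hi, complexVec_eq_zero]),
    (T.cam j).center_eq_mk hv' (by rw [complexVec_mulVec, hj, complexVec_eq_zero])]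

/-- Two cameras with distinct centers are jointly injective. -/
theorem CameraTuple.exists_left_inv {n : ℕ} (T : CameraTuple n) {i j : Fin n} (hij : i ≠ j) :
    ∃ G G' : Matrix (Fin 4) (Fin 3) ℝ, G * (T.cam i).mat + G' * (T.cam j).mat = 1 := by
  let F := Matrix.fromRows (T.cam i).mat (T.cam j).mat
  have hF : LinearMap.ker F.mulVecLin = ⊥ := by
    rw [LinearMap.ker_eq_bot']
    intro v hv
    have hv' : F *ᵥ v = 0 := hv
    rw [Matrix.fromRows_mulVec] at hv'
    exact T.eq_zero_of_mulVec hij (funext fun k => congrFun hv' (Sum.inl k))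
      (funext fun k => congrFun hv' (Sum.inr k))
  obtain ⟨g, hg⟩ := LinearMap.exists_leftInverse_of_injective _ hF
  have h1 : LinearMap.toMatrix' g * F = 1 := by
    have := congrArg LinearMap.toMatrix' hg
    rwa [LinearMap.toMatrix'_comp, LinearMap.toMatrix'_id, ← Matrix.toLin'_apply',
      LinearMap.toMatrix'_toLin'] at this
  refine ⟨(LinearMap.toMatrix' g).toCols₁, (LinearMap.toMatrix' g).toCols₂, ?_⟩
  rw [← Matrix.fromCols_mul_fromRows, Matrix.fromCols_toCols]
  exact h1

theorem Fin.exists_third : ∀ i j : Fin 3, ∃ k, i ≠ k ∧ j ≠ k := by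
  decide

theorem Fin.eq_of_distinct : ∀ i j k : Fin 3, i ≠ j → i ≠ k → j ≠ k →
    ∀ a, a = i ∨ a = j ∨ a = k := by
  decide

section PolynomialSolutions

open Polynomial

variable {M : Fin 3 → Matrix (Fin 3) (Fin 4) ℝ} {b : Fin 3 → Fin 4 → ℝ} {T : CameraTuple 3}
  {Y : Fin 4 → ℝ[X]} {c : Fin 3 → ℝ[X]}

theorem Matrix.toPoly_add {m n : Type*} (A B : Matrix m n ℝ) :
    (A + B).toPoly = A.toPoly + B.toPoly :=
  Matrix.map_add _ (map_add _) _ _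

theorem eq_of_left_inv {i j : Fin 3} {G G' : Matrix (Fin 4) (Fin 3) ℝ}
    (hG : G * (T.cam i).mat + G' * (T.cam j).mat = 1)
    (hY : ∀ i, (T.cam i).mat.toPoly *ᵥ Y = c i • (M i).toPoly *ᵥ momentVec 3 1 X) :
    Y = c i • (G * M i).toPoly *ᵥ momentVec 3 1 X +
      c j • (G' * M j).toPoly *ᵥ momentVec 3 1 X := by
  have h1 : (1 : Matrix (Fin 4) (Fin 4) ℝ).toPoly *ᵥ Y = Y := by
    simp [Matrix.toPoly]
  rw [← Matrix.toPoly_mulVec_mulVec, ← Matrix.toPoly_mulVec_mulVec,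
    ← Matrix.mulVec_smul G.toPoly, ← Matrix.mulVec_smul G'.toPoly, ← hY, ← hY, Matrix.toPoly_mulVec_mulVec, Matrix.toPoly_mulVec_mulVec,
    ← Matrix.add_mulVec, ← Matrix.toPoly_add, hG, h1]

theorem CollinearCameras.toPoly_ne_zero (hM : CollinearCameras M b) (i : Fin 3) :
    (M i).toPoly *ᵥ momentVec 3 1 (X : ℝ[X]) ≠ 0 := by
  intro h0
  have : M i = 0 := toPoly_mulVec_momentVec_injective (by rw [h0]; simp [Matrix.toPoly])
  obtain ⟨G, hG⟩ := hM.right_inv i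
  rw [this, Matrix.zero_mul] at hG
  exact zero_ne_one hG

/-- If c_i = 0, then Y stays in the kernel of T_i, a single point, while T_jY would trace the planar
image of the cubic, unless c_j = 0 too. In matrices, T_iG' = 0 and T_jG' = 1 contradict the ranks.
-/
theorem multiplier_ne_zero (hM : CollinearCameras M b) (hne : Y ≠ 0 ∨ c ≠ 0)
    (hY : ∀ i, (T.cam i).mat.toPoly *ᵥ Y = c i • (M i).toPoly *ᵥ momentVec 3 1 X) (i : Fin 3) :
    c i ≠ 0 := by
  intro hi
  obtain ⟨j, hj⟩ := exists_ne i
  obtain ⟨G, G', hG⟩ := T.exists_left_inv hj.symm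
  have hY' := eq_of_left_inv hG hY
  rw [hi, zero_smul, zero_add] at hY'
  by_cases hcj : c j = 0
  · rw [hcj, zero_smul] at hY'
    rcases hne with hne | hne
    · exact hne hY'
    · apply hne
      ext1 k
      have := hY k
      rw [hY', Matrix.mulVec_zero, eq_comm, smul_eq_zero] at this
      exact this.resolve_right (hM.toPoly_ne_zero k)
  · obtain ⟨N, hN⟩ := hM.right_inv j
    have e1 : (T.cam i).mat * G' = 0 := by
      have h1 := hY i
      rw [hY', hi, zero_smul, Matrix.mulVec_smul, Matrix.toPoly_mulVec_mulVec, smul_eq_zero,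
        or_iff_right hcj] at h1
      have h2 : (T.cam i).mat * (G' * M j) = 0 :=
        toPoly_mulVec_momentVec_injective (by rw [h1]; simp [Matrix.toPoly])
      rw [← Matrix.mul_one ((T.cam i).mat * G'), ← hN, ← Matrix.mul_assoc,
        Matrix.mul_assoc _ G', h2, Matrix.zero_mul]
    have e2 : (T.cam j).mat * G' = 1 := by
      have h1 := hY j
      rw [hY', Matrix.mulVec_smul, Matrix.toPoly_mulVec_mulVec] at h1
      have h2 : (T.cam j).mat * (G' * M j) = M j :=
        toPoly_mulVec_momentVec_injective (smul_right_injective _ hcj h1)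
      rw [← Matrix.mul_one ((T.cam j).mat * G'), ← hN, ← Matrix.mul_assoc,
        Matrix.mul_assoc _ G', h2]
    have r1 := Matrix.rank_add_rank_le_card_of_mul_eq_zero e1
    have r2 := Matrix.rank_mul_le_right (T.cam j).mat G'
    rw [e2, Matrix.rank_one] at r2
    rw [(T.cam i).full_rank] at r1
    simp at r1 r2
    omega

/-- A plane through b_i is the pullback of an image line under M_i, and pairing that line with T_iY
= c_i M_i m₃ gives a real combination of the coordinates of Y. -/
theorem multiplier_mul_mem_span (hM : CollinearCameras M b)
    (hY : ∀ i, (T.cam i).mat.toPoly *ᵥ Y = c i • (M i).toPoly *ᵥ momentVec 3 1 X) (i : Fin 3)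
    (v : Fin 4 → ℝ) (hv : v ⬝ᵥ b i = 0) :
    c i * cubicPoly v ∈ Submodule.span ℝ (Set.range Y) := by
  obtain ⟨u, rfl⟩ := hM.exists_vecMul_eq i hv
  have h1 : c i * cubicPoly (u ᵥ* M i) = (fun a => C (u a)) ⬝ᵥ ((T.cam i).mat.toPoly *ᵥ Y) := by
    rw [cubicPoly_vecMul, hY, dotProduct_smul, smul_eq_mul]
  rw [h1]
  simp only [Matrix.mulVec, dotProduct]
  refine Submodule.sum_mem _ fun a _ => Submodule.C_mul_mem (u a) ?_
  exact Submodule.sum_mem _ fun k _ => Submodule.C_mul_mem _ (Submodule.subset_span ⟨k, rfl⟩)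

theorem exists_linForm {p : ℝ[X]} (hp : p.natDegree ≤ 1) :
    ∃ l : Fin 2 → ℝ, p = linForm l 1 X := by
  refine ⟨![p.coeff 0, p.coeff 1], ?_⟩
  conv_lhs => rw [eq_X_add_C_of_natDegree_le_one hp]
  simp [linForm]
  ring

/-- Multipliers that are not all proportional are linear forms up to a common factor, and the
coordinates of the polynomial solution are independent. -/
theorem exists_linForm_multipliers (hM : CollinearCameras M b) (hne : Y ≠ 0 ∨ c ≠ 0)
    (hY : ∀ i, (T.cam i).mat.toPoly *ᵥ Y = c i • (M i).toPoly *ᵥ momentVec 3 1 X) {i j : Fin 3}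
    (hij : i ≠ j) (hind : ∀ x y : ℝ, C x * c i + C y * c j = 0 → x = 0 ∧ y = 0) :
    LinearIndependent ℝ Y ∧ ∃ (q : ℝ[X]) (l : Fin 3 → Fin 2 → ℝ), q ≠ 0 ∧
      (∀ a, c a = q * linForm (l a) 1 X) ∧
      ∀ a d, a ≠ d → ∀ x y : ℝ, C x * c a + C y * c d = 0 → x = 0 ∧ y = 0 := by
  obtain ⟨k, hik, hjk⟩ := Fin.exists_third i j
  have hcov := Fin.eq_of_distinct i j k hij hik hjk
  have hc0 := multiplier_ne_zero hM hne hY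
  have hV : Module.finrank ℝ (Submodule.span ℝ (Set.range Y)) ≤ 4 := by
    exact finrank_range_le_card (R := ℝ) Y
  obtain ⟨N, k₁, k₂, s, t, hp⟩ := hM.exists_pencilTriple hij hik hjk (hc0 k) hind
    (FiniteDimensional.span_of_finite ℝ (Set.finite_range Y)) hV (multiplier_mul_mem_span hM hY)
  obtain ⟨q, w, u, x, y, hq, dw, du, hx, hy, ei, ej, ek⟩ := hp.exists_linear_factors
  have hlin : ∀ a, ∃ l : Fin 2 → ℝ, c a = q * linForm l 1 X := by
    intro a
    rcases hcov a with rfl | rfl | rfl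
    · obtain ⟨l, rfl⟩ := exists_linForm dw
      exact ⟨l, ei⟩
    · obtain ⟨l, rfl⟩ := exists_linForm du
      exact ⟨l, ej⟩
    · obtain ⟨l, hl⟩ := exists_linForm (p := C x * w + C y * u)
        (natDegree_add_le_of_degree_le ((natDegree_C_mul_le _ _).trans dw)
          ((natDegree_C_mul_le _ _).trans du))
      exact ⟨l, hl ▸ ek⟩
  choose l hl using hlin
  -- The span V has dimension exactly four, so the four coordinates of Y are independent.
  refine ⟨linearIndependent_iff_card_eq_finrank_span.mpr hp.finrank_eq.symm,
    q, l, hq, hl, ?_⟩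
  have hki : ∀ z z' : ℝ, C z * c i + C z' * c k = 0 → z = 0 ∧ z' = 0 := by
    intro z z' h0
    have h1 := hind (z + z' * x) (z' * y) (by
      rw [ei, ej]; rw [ei, ek] at h0
      simp only [C_add, C_mul]
      linear_combination h0)
    have hz' := (mul_eq_zero.mp h1.2).resolve_right hy
    have h2 := h1.1
    rw [hz', zero_mul, add_zero] at h2
    exact ⟨h2, hz'⟩
  have hkj : ∀ z z' : ℝ, C z * c j + C z' * c k = 0 → z = 0 ∧ z' = 0 := by
    intro z z' h0
    have h1 := hind (z' * x) (z + z' * y) (by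
      rw [ei, ej]; rw [ej, ek] at h0
      simp only [C_add, C_mul]
      linear_combination h0)
    have hz' := (mul_eq_zero.mp h1.1).resolve_right hx
    have h2 := h1.2
    rw [hz', zero_mul, add_zero] at h2
    exact ⟨h2, hz'⟩
  intro a d had z z' h0
  have h0' : C z' * c d + C z * c a = 0 := by rwa [add_comm]
  rcases hcov a with rfl | rfl | rfl <;> rcases hcov d with rfl | rfl | rfl <;>
    first
      | exact absurd rfl had
      | exact hind z z' h0
      | exact hki z z' h0
      | exact hkj z z' h0
      | exact (hind z' z h0').symm
      | exact (hki z' z h0').symm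
      | exact (hkj z' z h0').symm

/-- Two cameras recover Y linearly from c_i M_i m₃ and c_j M_j m₃. With c_a = q·l_a this reads Y =
q·B m₄, and cancelling q gives the model; B has independent rows because Y has independent
coordinates. -/
theorem exists_quarticModel_of_solution (hM : CollinearCameras M b) (hne : Y ≠ 0 ∨ c ≠ 0)
    (hY : ∀ i, (T.cam i).mat.toPoly *ᵥ Y = c i • (M i).toPoly *ᵥ momentVec 3 1 X) {i j : Fin 3}
    (hij : i ≠ j) (hind : ∀ x y : ℝ, C x * c i + C y * c j = 0 → x = 0 ∧ y = 0) :
    ∃ B l, QuarticModel M (fun i => (T.cam i).mat) B l := by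
  obtain ⟨hli, q, l, hq, hl, hpair⟩ := exists_linForm_multipliers hM hne hY hij hind
  obtain ⟨G, G', hG⟩ := T.exists_left_inv hij
  have hshift : ∀ (a : Fin 3) {m : Type} (K : Matrix m (Fin 4) ℝ),
      c a • K.toPoly *ᵥ momentVec 3 1 X =
        q • (K * shiftMatrix (l a)).toPoly *ᵥ momentVec 4 1 X := by
    intro a m K
    rw [← Matrix.toPoly_mulVec_mulVec, shiftMatrix_mulVec_momentVec, hl, ← smul_smul,
      Matrix.mulVec_smul]
  have hYB := eq_of_left_inv hG hY
  rw [hshift i, hshift j, ← smul_add, ← Matrix.add_mulVec, ← Matrix.toPoly_add] at hYB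
  set B : Matrix (Fin 4) (Fin 5) ℝ := G * M i * shiftMatrix (l i) + G' * M j * shiftMatrix (l j)
  have hB : Y = q • B.toPoly *ᵥ momentVec 4 1 X := hYB
  refine ⟨B, l, fun a => ?_, ?_, fun a d had hD => ?_⟩
  · have h1 := hY a
    rw [hB, Matrix.mulVec_smul, Matrix.toPoly_mulVec_mulVec, hshift a] at h1
    exact toPoly_mulVec_momentVec_injective (smul_right_injective _ hq h1)
  · rw [← Matrix.vecMul_injective_iff]
    refine (injective_iff_map_eq_zero (Matrix.vecMulLinear B)).mpr fun g hg => ?_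
    have hg' : g ᵥ* B = 0 := hg
    have h1 : ∑ k, g k • Y k = 0 := by
      have h2 : (fun k => C (g k)) ⬝ᵥ (B.toPoly *ᵥ momentVec 4 1 X) = 0 := by
        have h3 : (fun k => C (g k)) ᵥ* B.toPoly = 0 := by
          ext1 k
          have := congrArg C (congrFun hg' k)
          simpa [Matrix.vecMul, dotProduct] using this
        rw [Matrix.dotProduct_mulVec, h3, zero_dotProduct]
      have h4 : ∑ k, g k • Y k = (fun k => C (g k)) ⬝ᵥ Y :=
        Finset.sum_congr rfl fun k _ => smul_eq_C_mul _
      rw [h4, hB, dotProduct_smul, h2, smul_zero]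
    exact funext (Fintype.linearIndependent_iff.mp hli g h1)
  · have hza : ∀ z z' : ℝ, z * l a 0 + z' * l d 0 = 0 → z * l a 1 + z' * l d 1 = 0 →
        z = 0 ∧ z' = 0 := by
      intro z z' e0 e1
      refine hpair a d had z z' ?_
      have f0 := congrArg C e0
      have f1 := congrArg C e1
      simp only [C_add, C_mul, C_0] at f0 f1
      rw [hl, hl]
      simp only [linForm, algebraMap_eq]
      linear_combination q * f0 + q * X * f1
    have k1 := hza (l d 0) (-l a 0) (by ring) (by linear_combination -hD)
    have k2 := hza (l d 1) (-l a 1) (by linear_combination hD) (by ring)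
    have k3 := hza 1 1 (by simp [neg_eq_zero.mp k1.2, k1.1]) (by simp [neg_eq_zero.mp k2.2, k2.1])
    exact one_ne_zero k3.1

/-- Proportional multipliers come from a projective transformation. -/
theorem exists_transformation_of_solution (hM : CollinearCameras M b) (hne : Y ≠ 0 ∨ c ≠ 0)
    (hY : ∀ i, (T.cam i).mat.toPoly *ᵥ Y = c i • (M i).toPoly *ᵥ momentVec 3 1 X)
    (hdep : ∀ j, j ≠ 0 → ¬ ∀ x y : ℝ, C x * c 0 + C y * c j = 0 → x = 0 ∧ y = 0) :
    ∃ (H : Matrix (Fin 4) (Fin 4) ℝ) (x : Fin 3 → ℝ), (∀ i, x i ≠ 0) ∧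
      ∀ i, (T.cam i).mat * H = x i • M i := by
  have hc0 := multiplier_ne_zero hM hne hY
  have hx : ∀ j, ∃ x : ℝ, x ≠ 0 ∧ c j = C x * c 0 := by
    intro j
    by_cases hj : j = 0
    · exact ⟨1, one_ne_zero, by simp [hj]⟩
    · have := hdep j hj
      push Not at this
      obtain ⟨x, y, h0, hxy⟩ := this
      have hy : y ≠ 0 := by
        rintro rfl
        have hx : x ≠ 0 := fun hx => hxy hx rfl
        simp [hx, hc0 0] at h0
      have hinv : C y⁻¹ * C y = 1 := by rw [← C_mul, inv_mul_cancel₀ hy, C_1]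
      have e : c j = C (-(y⁻¹ * x)) * c 0 := by
        rw [C_neg, C_mul]
        linear_combination C y⁻¹ * h0 - c j * hinv
      refine ⟨_, ?_, e⟩
      intro hz
      rw [hz, C_0, zero_mul] at e
      exact hc0 j e
  choose x hx0 hx using hx
  -- With every c_a a constant multiple of c₀, recovering Y from two views gives Y = c₀·H m₃ with H
  -- constant.
  obtain ⟨G, G', hG⟩ := T.exists_left_inv (i := 0) (j := 1) (by decide)
  have hYH := eq_of_left_inv hG hY
  have hscale : ∀ (a : Fin 3) {m : Type} (K : Matrix m (Fin 4) ℝ),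
      c a • K.toPoly *ᵥ momentVec 3 1 X = c 0 • (x a • K).toPoly *ᵥ momentVec 3 1 X := by
    intro a m K
    rw [hx, smul_toPoly_mulVec, smul_smul, mul_comm]
  rw [hscale 0, hscale 1, ← smul_add, ← Matrix.add_mulVec, ← Matrix.toPoly_add] at hYH
  refine ⟨x 0 • (G * M 0) + x 1 • (G' * M 1), x, hx0, fun a => ?_⟩
  have h1 := hY a
  rw [hYH, Matrix.mulVec_smul, Matrix.toPoly_mulVec_mulVec, hscale a] at h1
  exact toPoly_mulVec_momentVec_injective (smul_right_injective _ (hc0 0) h1)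

end PolynomialSolutions

/-! ### Conjugates of the whole cubic -/

/-- If `(P, X)` and `(T, R)` are reconstructions of the same set, then each point of `X` that is no
camera center is seen by `P` as some point of `R` is seen by `T`. -/
theorem IsReconstruction.exists_mulVec_eq {n : ℕ} {S : Set (Fin n → Image)} {P T : CameraTuple n}
    {X R : Set Space} (hP : IsReconstruction S P X) (hT : IsReconstruction S T R)
    {v : Fin 4 → ℂ} (hv : v ≠ 0) (hvX : Projectivization.mk ℂ v hv ∈ X)
    (hne : ∀ i, (P.cam i).mat.toComplex *ᵥ v ≠ 0) :
    ∃ (y : Fin 4 → ℂ) (hy : y ≠ 0), Projectivization.mk ℂ y hy ∈ R ∧ ∀ i, ∃ c : ℂ,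
      (T.cam i).mat.toComplex *ᵥ y = c • (P.cam i).mat.toComplex *ᵥ v := by
  obtain ⟨z, hz, hs⟩ := hP.2 _ hvX
  obtain ⟨y, hy, hs'⟩ := hT.1 z hz
  induction y using Projectivization.ind with
  | h y hy0 =>
    rw [CameraTuple.sees_mk] at hs hs'
    refine ⟨y, hy0, hy, fun i => ?_⟩
    obtain ⟨c, hc⟩ := hs i
    obtain ⟨c', hc'⟩ := hs' i
    have hc0 : c ≠ 0 := by
      rintro rfl
      exact hne i (by rw [hc, zero_smul])
    exact ⟨c' * c⁻¹, by rw [hc, hc', smul_smul, mul_assoc, inv_mul_cancel₀ hc0, mul_one]⟩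

theorem projTransform_mk (K : GL (Fin 4) ℝ) {v y : Fin 4 → ℂ} (hv : v ≠ 0) (hy : y ≠ 0) {c : ℂ}
    (h : y = c • K.val.toComplex *ᵥ v) :
    projTransform K (Projectivization.mk ℂ v hv) = Projectivization.mk ℂ y hy := by
  have hKv : K.val.toComplex *ᵥ v ≠ 0 := by
    intro h0
    exact hy (by rw [h, h0, smul_zero])
  exact (projectivization_mk_eq hy hKv h).symm

section Conjugate

variable {A A' : Matrix (Fin 4) (Fin 4) ℝ} {P T : CameraTuple 3} {b : Fin 3 → Fin 4 → ℝ}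
  {C R : Set Space}

/-- A projective transformation relating the two sides of a pair of reconstructions of a twisted
cubic is an equivalence of configurations. -/
theorem configEquiv_of_transformation (hA : A * A' = 1)
    (hM : CollinearCameras (fun i => (P.cam i).mat * A) b)
    (hC : C = {x | ∃ (s t : ℂ) (h : A.toComplex *ᵥ momentVec 3 s t ≠ 0),
        (s ≠ 0 ∨ t ≠ 0) ∧ x = Projectivization.mk ℂ _ h})
    (hto : ∀ s t : ℂ, (s ≠ 0 ∨ t ≠ 0) → ∃ (y : Fin 4 → ℂ) (hy : y ≠ 0),
      Projectivization.mk ℂ y hy ∈ R ∧ ∀ i, ∃ c : ℂ, (T.cam i).mat.toComplex *ᵥ y =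
        c • ((P.cam i).mat * A).toComplex *ᵥ momentVec 3 s t)
    (hfrom : ∀ (y : Fin 4 → ℂ) (hy : y ≠ 0), Projectivization.mk ℂ y hy ∈ R →
      ∃ s t : ℂ, (s ≠ 0 ∨ t ≠ 0) ∧ ∀ i, ∃ c : ℂ, (T.cam i).mat.toComplex *ᵥ y =
        c • ((P.cam i).mat * A).toComplex *ᵥ momentVec 3 s t)
    {H : Matrix (Fin 4) (Fin 4) ℝ} {x : Fin 3 → ℝ} (hx : ∀ i, x i ≠ 0)
    (hH : ∀ i, (T.cam i).mat * H = x i • ((P.cam i).mat * A)) : ConfigEquiv P C T R := by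
  have hA' : A' * A = 1 := mul_eq_one_comm.mp hA
  have hHinj : Function.Injective H.mulVec := by
    refine (injective_iff_map_eq_zero H.mulVecLin).mpr fun v hv => ?_
    have hv' : H *ᵥ v = 0 := hv
    have hv0 : ∀ i, ((P.cam i).mat * A) *ᵥ v = 0 := by
      intro i
      have := congrArg (· *ᵥ v) (hH i)
      simp only [← Matrix.mulVec_mulVec, hv', Matrix.mulVec_zero, Matrix.smul_mulVec] at this
      rw [← Matrix.mulVec_mulVec]
      exact (smul_eq_zero.mp this.symm).resolve_left (hx i)
    obtain ⟨c, hc⟩ := hM.ker_real 0 (hv0 0)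
    obtain ⟨c', hc'⟩ := hM.ker_real 1 (hv0 1)
    have := hM.indep 0 1 (by decide) c (-c') (by rw [neg_smul, ← hc, ← hc', add_neg_cancel])
    rw [hc, this.1, zero_smul]
  have hHunit : IsUnit (H * A') :=
    (Matrix.mulVec_injective_iff_isUnit.mp hHinj).mul (IsUnit.of_mul_eq_one A hA')
  obtain ⟨K, hK⟩ := hHunit
  obtain ⟨W, hW⟩ : ∃ W, H * W = 1 :=
    (Matrix.mulVec_injective_iff_isUnit.mp hHinj).exists_right_inv
  have hHA : ∀ v : Fin 4 → ℂ, K.val.toComplex *ᵥ (A.toComplex *ᵥ v) = H.toComplex *ᵥ v := by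
    intro v
    rw [Matrix.toComplex_mulVec_mulVec, hK, Matrix.mul_assoc, hA', Matrix.mul_one]
  -- Pulled back by H, such a point lies on the lines joining m₃(s, t) to b₀ and to b₁. These meet
  -- only in m₃(s, t), since the cubic misses the line of centers. So equal images force equal
  -- points, and R is exactly the transformed cubic.
  have hfib : ∀ {s t : ℂ} (hst : s ≠ 0 ∨ t ≠ 0) {y : Fin 4 → ℂ}, (∀ i, ∃ c : ℂ,
      (T.cam i).mat.toComplex *ᵥ y = c • ((P.cam i).mat * A).toComplex *ᵥ momentVec 3 s t) →
      ∃ c : ℂ, y = c • H.toComplex *ᵥ momentVec 3 s t := by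
    intro s t hst y hy
    have hyW : y = H.toComplex *ᵥ (W.toComplex *ᵥ y) := by
      rw [Matrix.toComplex_mulVec_mulVec, hW]
      simp [Matrix.toComplex]
    set w := W.toComplex *ᵥ y
    have hw : ∀ i, ∃ c d : ℂ, w = c • momentVec 3 s t + d • complexVec (b i) := by
      intro i
      obtain ⟨c, hc⟩ := hy i
      have hx' : (x i : ℂ) ≠ 0 := by exact_mod_cast hx i
      rw [hyW, Matrix.toComplex_mulVec_mulVec, hH, Matrix.toComplex_smul, Matrix.smul_mulVec] at hc
      obtain ⟨d, hd⟩ := hM.ker i (w - ((x i : ℂ)⁻¹ * c) • momentVec 3 s t) (by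
        rw [Matrix.mulVec_sub, Matrix.mulVec_smul, ← smul_smul, ← hc, smul_smul,
          inv_mul_cancel₀ hx', one_smul, sub_self])
      exact ⟨_, d, by rw [← hd]; abel⟩
    obtain ⟨c, d, e⟩ := hw 0
    obtain ⟨c', d', e'⟩ := hw 1
    have hcc : c - c' = 0 := by
      by_contra hne
      refine hM.disjoint 0 1 s t hst ((c - c')⁻¹ * -d) ((c - c')⁻¹ * d') ?_
      have h1 : (c - c') • momentVec 3 s t = -d • complexVec (b 0) + d' • complexVec (b 1) := by
        rw [e] at e'
        linear_combination (norm := module) e'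
      rw [← smul_smul, ← smul_smul, ← smul_add, ← h1, smul_smul, inv_mul_cancel₀ hne, one_smul]
    have hdd := complexVec_pair_eq_zero (hM.indep 0 1 (by decide)) (x := d) (y := -d') (by
      rw [e, sub_eq_zero.mp hcc, add_right_inj] at e'
      rw [e', neg_smul, add_neg_cancel])
    refine ⟨c, ?_⟩
    rw [hyW, e, hdd.1, zero_smul, add_zero, Matrix.mulVec_smul]
  refine ⟨K, ?_, fun i => ⟨(x i)⁻¹, inv_ne_zero (hx i), ?_⟩⟩
  · ext y
    constructor
    · rintro ⟨x, hxC, rfl⟩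
      rw [hC] at hxC
      obtain ⟨s, t, h0, hst, rfl⟩ := hxC
      obtain ⟨y, hy, hyR, hyc⟩ := hto s t hst
      obtain ⟨c, hc⟩ := hfib hst hyc
      rwa [projTransform_mk K h0 hy (c := c) (by rw [hc, ← hHA])]
    · induction y using Projectivization.ind with
      | h y hy =>
        intro hyR
        obtain ⟨s, t, hst, hyc⟩ := hfrom y hy hyR
        obtain ⟨c, hc⟩ := hfib hst hyc
        have h0 : A.toComplex *ᵥ momentVec 3 s t ≠ 0 := by
          intro h0
          apply hy
          rw [hc, ← hHA, h0, Matrix.mulVec_zero, smul_zero]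
        refine ⟨Projectivization.mk ℂ _ h0, ?_, ?_⟩
        · rw [hC]
          exact ⟨s, t, h0, hst, rfl⟩
        · exact projTransform_mk K h0 hy (by rw [hc, ← hHA])
  · have h1 : (P.cam i).mat = (x i)⁻¹ • ((T.cam i).mat * K.val) := by
      rw [hK, ← Matrix.mul_assoc, hH, Matrix.smul_mul, Matrix.mul_assoc, hA, Matrix.mul_one,
        smul_smul, inv_mul_cancel₀ (hx i), one_smul]
    rw [h1, Matrix.smul_mul, Matrix.mul_assoc, Units.mul_inv, Matrix.mul_one]

/-- The points of a reconstruction by a quartic model form the quartic. -/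
theorem QuarticModel.isRationalQuartic {B : Matrix (Fin 4) (Fin 5) ℝ} {l : Fin 3 → Fin 2 → ℝ}
    (h : QuarticModel (fun i => (P.cam i).mat * A) (fun i => (T.cam i).mat) B l)
    (hM : CollinearCameras (fun i => (P.cam i).mat * A) b)
    (hto : ∀ s t : ℂ, (s ≠ 0 ∨ t ≠ 0) → ∃ (y : Fin 4 → ℂ) (hy : y ≠ 0),
      Projectivization.mk ℂ y hy ∈ R ∧ ∀ i, ∃ c : ℂ, (T.cam i).mat.toComplex *ᵥ y =
        c • ((P.cam i).mat * A).toComplex *ᵥ momentVec 3 s t)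
    (hfrom : ∀ (y : Fin 4 → ℂ) (hy : y ≠ 0), Projectivization.mk ℂ y hy ∈ R →
      ∃ s t : ℂ, (s ≠ 0 ∨ t ≠ 0) ∧ ∀ i, ∃ c : ℂ, (T.cam i).mat.toComplex *ᵥ y =
        c • ((P.cam i).mat * A).toComplex *ᵥ momentVec 3 s t) :
    IsRationalQuartic R ∧ ∀ i, (T.cam i).center ∈ R := by
  have hker : ∀ i, ∃ d : Fin 4 → ℂ, ∀ v, (T.cam i).mat.toComplex *ᵥ v = 0 →
      ∃ c : ℂ, v = c • d := by
    intro i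
    obtain ⟨d, -, -, hd⟩ := (T.cam i).exists_kernel
    exact ⟨_, hd⟩
  have hR : R = {x | ∃ (s t : ℂ) (h : B.toComplex *ᵥ monomialVec 4 s t ≠ 0),
      (s ≠ 0 ∨ t ≠ 0) ∧ x = Projectivization.mk ℂ _ h} := by
    ext y
    constructor
    · induction y using Projectivization.ind with
      | h y hy =>
        intro hyR
        obtain ⟨s, t, hst, hyc⟩ := hfrom y hy hyR
        obtain ⟨c, hc⟩ := h.eq_smul_of_mulVec hM hker hst hyc
        exact ⟨s, t, h.mulVec_momentVec_ne_zero hM hst, hst, projectivization_mk_eq _ _ hc⟩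
    · rintro ⟨s, t, h0, hst, rfl⟩
      obtain ⟨y, hy, hyR, hyc⟩ := hto s t hst
      obtain ⟨c, hc⟩ := h.eq_smul_of_mulVec hM hker hst hyc
      rwa [← projectivization_mk_eq hy h0 hc]
  refine ⟨⟨B, h.rows, fun s t hst => h.mulVec_momentVec_ne_zero hM hst, hR⟩, fun i => ?_⟩
  rw [hR]
  have h0 := h.mulVec_momentVec_ne_zero hM (h.root_ne_zero i)
  exact ⟨_, _, h0, h.root_ne_zero i, (T.cam i).center_eq_mk h0 (h.mulVec_root i)⟩

theorem IsConjugate.isRationalQuartic (hA : A * A' = 1)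
    (hM : CollinearCameras (fun i => (P.cam i).mat * A) b)
    (hC : C = {x | ∃ (s t : ℂ) (h : A.toComplex *ᵥ momentVec 3 s t ≠ 0),
        (s ≠ 0 ∨ t ≠ 0) ∧ x = Projectivization.mk ℂ _ h})
    (h : IsConjugate P C T R) : IsRationalQuartic R ∧ ∀ i, (T.cam i).center ∈ R := by
  obtain ⟨⟨S, hP, hT⟩, hequiv⟩ := h
  have hPne : ∀ s t : ℂ, (s ≠ 0 ∨ t ≠ 0) → ∀ i,
      (P.cam i).mat.toComplex *ᵥ (A.toComplex *ᵥ momentVec 3 s t) ≠ 0 := by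
    intro s t hst i
    rw [Matrix.toComplex_mulVec_mulVec]
    exact hM.mulVec_momentVec_ne_zero i hst
  have hne : ∀ s t : ℂ, (s ≠ 0 ∨ t ≠ 0) → A.toComplex *ᵥ momentVec 3 s t ≠ 0 := by
    intro s t hst h0
    exact hPne s t hst 0 (by rw [h0, Matrix.mulVec_zero])
  have hto : ∀ s t : ℂ, (s ≠ 0 ∨ t ≠ 0) → ∃ (y : Fin 4 → ℂ) (hy : y ≠ 0),
      Projectivization.mk ℂ y hy ∈ R ∧ ∀ i, ∃ c : ℂ, (T.cam i).mat.toComplex *ᵥ y =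
        c • ((P.cam i).mat * A).toComplex *ᵥ momentVec 3 s t := by
    intro s t hst
    simp only [← Matrix.toComplex_mulVec_mulVec]
    exact hP.exists_mulVec_eq hT (hne s t hst) (by rw [hC]; exact ⟨s, t, _, hst, rfl⟩)
      (hPne s t hst)
  have hfrom : ∀ (y : Fin 4 → ℂ) (hy : y ≠ 0), Projectivization.mk ℂ y hy ∈ R →
      ∃ s t : ℂ, (s ≠ 0 ∨ t ≠ 0) ∧ ∀ i, ∃ c : ℂ, (T.cam i).mat.toComplex *ᵥ y =
        c • ((P.cam i).mat * A).toComplex *ᵥ momentVec 3 s t := by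
    intro y hy hyR
    obtain ⟨z, hz, hs⟩ := hT.2 _ hyR
    obtain ⟨x, hx, hs'⟩ := hP.1 z hz
    rw [hC] at hx
    obtain ⟨s, t, h0, hst, rfl⟩ := hx
    rw [CameraTuple.sees_mk] at hs hs'
    refine ⟨s, t, hst, fun i => ?_⟩
    obtain ⟨c, hc⟩ := hs i
    obtain ⟨c', hc'⟩ := hs' i
    have hc0 : c' ≠ 0 := by
      rintro rfl
      exact hPne s t hst i (by rw [hc', zero_smul])
    rw [← Matrix.toComplex_mulVec_mulVec]
    exact ⟨c * c'⁻¹, by rw [hc, hc', smul_smul, mul_assoc, inv_mul_cancel₀ hc0, mul_one]⟩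
  obtain ⟨Y, c, hYc, hY⟩ := exists_polynomial_solution (fun i => (P.cam i).mat * A)
    (fun i => (T.cam i).mat) (fun τ => by
      obtain ⟨y, hy, -, hyc⟩ := hto 1 τ (by simp)
      choose c hc using hyc
      exact ⟨y, c, hy, hc⟩)
  -- Either every multiplier is proportional to c₀, which makes the configurations equivalent, or
  -- one is independent of c₀, which produces a quartic model.
  by_cases hdep : ∀ j, j ≠ 0 → ¬ ∀ x y : ℝ,
      Polynomial.C x * c 0 + Polynomial.C y * c j = 0 → x = 0 ∧ y = 0
  · obtain ⟨H, x, hx, hH⟩ := exists_transformation_of_solution hM hYc hY hdep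
    exact absurd (configEquiv_of_transformation hA hM hC hto hfrom hx hH) hequiv
  · push Not at hdep
    obtain ⟨j, hj, hind⟩ := hdep
    obtain ⟨B, l, hB⟩ := exists_quarticModel_of_solution hM hYc hY hj.symm hind
    exact hB.isRationalQuartic hM hto hfrom

end Conjugate

theorem mainTheorem8 (P : CameraTuple 3) (L C : Set Space)
    (hL : IsLine L) (hPL : ∀ i, (P.cam i).center ∈ L)
    (hC : IsTwistedCubic C) (hdisj : Disjoint C L) :
    -- every set of points on the cubic gives a critical configuration
    (∀ X ⊆ C, IsCritical P X) ∧
    -- the whole cubic has a conjugate, which restricts to conjugates of all its subsets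
    (∃ (Q : CameraTuple 3) (R : Set Space), IsNontrivialConjugate P C Q R ∧
      ∀ X ⊆ C, ∃ Y ⊆ R, IsNontrivialConjugate P X Q Y) ∧
    -- any conjugate of the whole cubic is a rational quartic through the conjugate centers
    (∀ (Q : CameraTuple 3) (R : Set Space), IsConjugate P C Q R →
      IsRationalQuartic R ∧ ∀ i, (Q.cam i).center ∈ R) := by
  obtain ⟨A, A', b, hA, hM, hCA⟩ := exists_collinearCameras P L C hL hPL hC hdisj
  obtain ⟨Q, B, l, hB⟩ := hM.exists_quarticModel
  obtain ⟨T, hT⟩ := hB.exists_cameraTuple hM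
  obtain rfl : (fun i => (T.cam i).mat) = Q := funext hT
  have hconj : ∀ X ⊆ C, IsNontrivialConjugate P X T (QuarticModel.pointsOver A B X) :=
    fun X hX => hB.isNontrivialConjugate hA hM (hX.trans hCA.subset)
  refine ⟨fun X hX => ⟨T, _, hconj X hX⟩,
    ⟨T, QuarticModel.pointsOver A B C, hconj C subset_rfl, fun X hX => ⟨_, ?_, hconj X hX⟩⟩,
    fun T R h => h.isRationalQuartic hA hM hCA⟩
  rintro y ⟨s, t, h1, h2, hst, hx, rfl⟩
  exact ⟨s, t, h1, h2, hst, hX hx, rfl⟩
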